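/- Let $\mathbf k$ be a field of characteristic zero and let $\mathcal P=\Gamma(E)/(R)$ be a quadratic operad of $\mathbf k$-vector spaces, where $E$ is a finite dimensional $\mathbf k[\Sigma_2]$-module of binary generators, $\Gamma(E)$ is the free operad on $E$, and $R\subseteq\Gamma(E)(3)$ is a $\Sigma_3$-stable subspace (for instance, any quadratic Koszul operad; Koszulness is not needed). Let $\mathcal P^!=\Gamma(E^\vee)/(R^\perp)$, $E^\vee=E^{\#}\otimes \mathrm{sgn}_2$, be its quadratic dual. For a $\mathcal P$-algebra $A$ with structure map $\alpha:\mathcal P\to \mathcal End_A$ let $$C^m_{\mathcal P}(A;A)=\left[\mathrm{Lin}(A^{\otimes (m+1)},A)\otimes\mathcal P^!(m+1)\otimes \mathrm{sgn}_{m+1}\right]^{\Sigma_{m+1}},\qquad m\ge 0,$$ be its operadic cochain complex, with the differential $d_{\mathcal P}f=[\chi_A,f]$, where $[f,g]=f\circ g-(-1)^{|f||g|}g\circ f$ is the Lie bracket induced by the operadic pre-Lie product $f\circ g=\sum_i\pm f\circ_i g$ of the (suspended) operad $\mathcal End_A\otimes\mathcal P^!$, and $\chi_A$ is the image under $\alpha\otimes\mathrm{id}$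 of the canonical element of $\mathcal P(2)\otimes\mathcal P^!(2)\cong E\otimes E^{\#}$ corresponding to $\mathrm{id}_E$. A natural unary operation $C^m_{\mathcal P}(A;A)\to C^{m'}_{\mathcal P}(A;A)$ is a linear combination (with coefficients independent of $A$) of operations $U_{(T,\Phi)}$ given by a rooted tree $T$ with $m'+1$ input legs labelled bijectively by $1,\dots,m'+1$, exactly one white vertex, which has $m+1$ linearly ordered inputs, and any number of black vertices of arity at least two decorated by elements of $\mathcal P$, and by a linear map $\Phi:\mathcal P^!(m+1)\to\mathcal P^!(m'+1)$: writing $f=\sum_\kappa\phi^\kappa\otimes q_\kappa$, one puts $U_{(T,\Phi)}(f)=\mathrm{Aver}\left(\sum_\kappa T(\phi^\kappa)\otimes\Phi(q_\kappa)\right)$, where $T(\phi)\in \mathrm{Lin}(A^{\otimes(m'+1)},A)$ is the composition along $T$ with the white vertex decorated by $\phi$ and the black ones decorated through $\alpha$, and $\mathrm{Aver}$ is the averaging over the $\Sigma_{m'+1}$-action. Let $\mathcal B^d_{\mathcal P}(1)$ be the space of families of linear maps $C^*_{\mathcal P}(A;A)\to C^{*+d}_{\mathcal P}(A;A)$, indexed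 by all $\mathcal P$-algebras $A$, each of whose components $C^m_{\mathcal P}(A;A)\to C^{m+d}_{\mathcal P}(A;A)$ is a natural unary operation. Composition and $\delta_{\mathcal P}(U)=d_{\mathcal P}U-(-1)^{|U|}Ud_{\mathcal P}$ make $\mathcal B_{\mathcal P}(1)$ a unital differential graded associative algebra. Let $\mathrm{End}_{\mathcal P^!}(\mathcal P^!)$ be the algebra, under composition, of endomorphisms of $\mathcal P^!$ as a module over itself, that is, of collections of equivariant linear maps $\alpha_n:\mathcal P^!(n)\to\mathcal P^!(n)$ with $\alpha(p\circ_i q)=p\circ_i\alpha(q)=\alpha(p)\circ_i q$ for all $p$, $q$, $i$. **Proposition.** There are canonical isomorphisms of unital associative $\mathbf k$-algebras $$H^0(\mathcal B_{\mathcal P}(1),\delta_{\mathcal P})\;\cong\;\mathrm{End}_{\mathcal P^!}(\mathcal P^!)\;\cong\;\mathbf k .$$ The first one is characterized by the property that every degree zero cocycle $z$ whose class corresponds to $\alpha\in \mathrm{End}_{\mathcal P^!}(\mathcal P^!)$ acts on each $C^m_{\mathcal P}(A;A)$ as $\mathrm{id}\otimes\alpha_{m+1}$; the second one sends $\alpha$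 to the scalar $c$ with $\alpha_1(1)=c\cdot 1$, where $1\in\mathcal P^!(1)$ is the operadic unit. -/

import Mathlib

open scoped TensorProduct DirectSum

universe u

namespace OperadicNatOp

/-! ### Symmetric operads in vector spaces -/

/-- A labelling, by `Fin N`, of the inputs of the operation obtained by plugging an operation with
`n` inputs into the input `i` of an operation with `m` inputs. -/
abbrev Graft {m : ℕ} (i : Fin m) (n N : ℕ) : Type :=
  ({x : Fin m // x ≠ i} ⊕ Fin n) ≃ Fin N

open Sum in
/-- A symmetric (unital) operad of `k`-vector spaces, given by partial compositions.
`relabel σ p` is `p` with its input `x` renamed to `σ x` (for `m = n` this is the symmetric group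
action, the right action being `p σ = relabel σ⁻¹ p`). `comp i e p q` is the partial composition
`p ∘ᵢ q` with its inputs labelled by `e`; the classical `p ∘ᵢ q` is the case in which `e` is the
order preserving labelling `Graft.std`, and the other labellings are obtained from it through the
symmetric group action (`relabel_comp`). -/
structure Operad (k : Type u) [Field k] where
  obj : ℕ → Type u
  [addCommGroup : ∀ n, AddCommGroup (obj n)]
  [module : ∀ n, Module k (obj n)]
  relabel : ∀ {m n : ℕ}, (Fin m ≃ Fin n) → obj m →ₗ[k] obj n
  comp : ∀ {m n N : ℕ} (i : Fin m), Graft i n N → obj m →ₗ[k] obj n →ₗ[k] obj N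
  one : obj 1
  relabel_refl : ∀ {n : ℕ} (p : obj n), relabel (Equiv.refl (Fin n)) p = p
  relabel_trans : ∀ {l m n : ℕ} (σ : Fin l ≃ Fin m) (τ : Fin m ≃ Fin n) (p : obj l),
    relabel τ (relabel σ p) = relabel (σ.trans τ) p
  relabel_comp : ∀ {m n N M : ℕ} (i : Fin m) (e : Graft i n N) (ρ : Fin N ≃ Fin M)
    (p : obj m) (q : obj n), relabel ρ (comp i e p q) = comp i (e.trans ρ) p q
  comp_relabel : ∀ {m m' n n' N : ℕ} (i : Fin m) (σ : Fin m ≃ Fin m') (τ : Fin n ≃ Fin n')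
    (e : Graft i n N) (e' : Graft (σ i) n' N),
    (∀ x : {x : Fin m // x ≠ i}, e' (inl ⟨σ x, fun h => x.2 (σ.injective h)⟩) = e (inl x)) →
    (∀ y : Fin n, e' (inr (τ y)) = e (inr y)) →
    ∀ (p : obj m) (q : obj n), comp (σ i) e' (relabel σ p) (relabel τ q) = comp i e p q
  comp_one : ∀ {m N : ℕ} (i : Fin m) (e : Graft i 1 N) (σ : Fin m ≃ Fin N),
    (∀ x : {x : Fin m // x ≠ i}, σ x = e (inl x)) → σ i = e (inr 0) →
    ∀ p : obj m, comp i e p one = relabel σ p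
  one_comp : ∀ {n N : ℕ} (i : Fin 1) (e : Graft i n N) (σ : Fin n ≃ Fin N),
    (∀ y : Fin n, σ y = e (inr y)) → ∀ q : obj n, comp i e one q = relabel σ q
  comp_comp : ∀ {m n l N M L : ℕ} (i : Fin m) (j : Fin n)
    (e : Graft i n N) (e' : Graft (e (inr j)) l L) (f : Graft j l M) (f' : Graft i M L),
    (∀ x : {x : Fin m // x ≠ i},
      e' (inl ⟨e (inl x), fun h => inl_ne_inr (e.injective h)⟩) = f' (inl x)) →
    (∀ y : {y : Fin n // y ≠ j},
      e' (inl ⟨e (inr y), fun h => y.2 (inr_injective (e.injective h))⟩) =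
        f' (inr (f (inl y)))) →
    (∀ z : Fin l, e' (inr z) = f' (inr (f (inr z)))) →
    ∀ (p : obj m) (q : obj n) (r : obj l),
      comp (e (inr j)) e' (comp i e p q) r = comp i f' p (comp j f q r)
  comp_comm : ∀ {m n l N M L : ℕ} (i j : Fin m) (hij : i ≠ j)
    (e : Graft i n N) (e' : Graft (e (inl ⟨j, hij.symm⟩)) l L)
    (f : Graft j l M) (f' : Graft (f (inl ⟨i, hij⟩)) n L),
    (∀ (x : Fin m) (hi : x ≠ i) (hj : x ≠ j),
      e' (inl ⟨e (inl ⟨x, hi⟩),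
        fun h => hj (congrArg Subtype.val (inl_injective (e.injective h)))⟩) =
      f' (inl ⟨f (inl ⟨x, hj⟩),
        fun h => hi (congrArg Subtype.val (inl_injective (f.injective h)))⟩)) →
    (∀ y : Fin n, e' (inl ⟨e (inr y), fun h => inr_ne_inl (e.injective h)⟩) = f' (inr y)) →
    (∀ z : Fin l, e' (inr z) = f' (inl ⟨f (inr z), fun h => inr_ne_inl (f.injective h)⟩)) →
    ∀ (p : obj m) (q : obj n) (r : obj l),
      comp (e (inl ⟨j, hij.symm⟩)) e' (comp i e p q) r =
        comp (f (inl ⟨i, hij⟩)) f' (comp j f p r) q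

attribute [instance] Operad.addCommGroup Operad.module

/-- The order preserving labelling of the inputs of `p ∘ᵢ q`, where `p` has `m + 1` and `q` has
`n + 1` inputs: first the inputs of `p` before `i`, then those of `q`, then the remaining ones. -/
noncomputable def Graft.std {m n N : ℕ} (i : Fin (m + 1)) (hN : m + n = N) :
    Graft i (n + 1) (N + 1) :=
  Equiv.ofBijective
    (fun s => match s with
      | Sum.inl x => if x.1 < i then ⟨x.1.1, by omega⟩ else ⟨x.1.1 + n, by omega⟩
      | Sum.inr y => ⟨i.1 + y.1, by omega⟩) (by
    rw [Fintype.bijective_iff_injective_and_card]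
    constructor
    · have hne : ∀ x : {x : Fin (m + 1) // x ≠ i}, x.1.1 ≠ i.1 := fun ⟨_, hx⟩ h => hx (Fin.ext h)
      rintro (x | x) (y | y) h
      · have hx := hne x
        have hy := hne y
        have : x.1.1 = y.1.1 := by
          simp only [Fin.lt_def] at h
          split_ifs at h <;> simp only [Fin.mk.injEq] at h <;> omega
        exact congrArg Sum.inl (Subtype.ext (Fin.ext this))
      · have hx := hne x
        exfalso
        simp only [Fin.lt_def] at h
        split_ifs at h <;> simp only [Fin.mk.injEq] at h <;> omega
      · have hy := hne y
        exfalso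
        simp only [Fin.lt_def] at h
        split_ifs at h <;> simp only [Fin.mk.injEq] at h <;> omega
      · simp only [Fin.mk.injEq] at h
        exact congrArg Sum.inr (Fin.ext (by omega))
    · simp only [ne_eq, Fintype.card_sum, Fintype.card_fin]
      rw [Fintype.card_subtype_compl, Fintype.card_subtype_eq, Fintype.card_fin]
      omega)

/-- Morphisms of operads. -/
structure Operad.Hom {k : Type u} [Field k] (P Q : Operad k) where
  toFun : ∀ n : ℕ, P.obj n →ₗ[k] Q.obj n
  map_relabel : ∀ {m n : ℕ} (σ : Fin m ≃ Fin n) (p : P.obj m),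
    toFun n (P.relabel σ p) = Q.relabel σ (toFun m p)
  map_comp : ∀ {m n N : ℕ} (i : Fin m) (e : Graft i n N) (p : P.obj m) (q : P.obj n),
    toFun N (P.comp i e p q) = Q.comp i e (toFun m p) (toFun n q)
  map_one : toFun 1 P.one = Q.one

/-! ### The endomorphism operad and algebras over an operad -/

section EndOperad

variable {k : Type u} [Field k] {A : Type u}

/-- The arguments of `f` in `f ∘ᵢ g`: the value `v` at the input `i`, and elsewhere the entries
of `x` named by the labelling `e`. -/
def Graft.args {m n N : ℕ} {i : Fin m} (e : Graft i n N) (x : Fin N → A) (v : A) : Fin m → A :=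
  fun j => if h : j = i then v else x (e (Sum.inl ⟨j, h⟩))

theorem Graft.args_eq_update [Zero A] {m n N : ℕ} {i : Fin m} (e : Graft i n N) (x : Fin N → A) (v : A) :
    e.args x v = Function.update (e.args x 0) i v := by
  funext j
  by_cases h : j = i
  · subst h; simp [Graft.args]
  · simp [Graft.args, h]

theorem Graft.args_update_inl {m n N : ℕ} {i : Fin m} (e : Graft i n N) (x : Fin N → A) (v : A)
    (j : {x : Fin m // x ≠ i}) (a : A) :
    e.args (Function.update x (e (Sum.inl j)) a) v = Function.update (e.args x v) j a := by
  funext c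
  by_cases h : c = i
  · have : c ≠ j := fun h' => j.2 (h' ▸ h)
    simp [Graft.args, h, Function.update_of_ne (h ▸ this)]
  · by_cases hc : c = j
    · subst hc; simp [Graft.args, j.2]
    · have : (⟨c, h⟩ : {x : Fin m // x ≠ i}) ≠ j := fun h' => hc (congrArg Subtype.val h')
      simp [Graft.args, h, hc, this]

theorem Graft.args_update_inr {m n N : ℕ} {i : Fin m} (e : Graft i n N) (x : Fin N → A) (v : A)
    (j : Fin n) (a : A) :
    e.args (Function.update x (e (Sum.inr j)) a) v = e.args x v := by
  funext c
  by_cases h : c = i <;> simp [Graft.args, h]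

theorem Graft.update_inl_comp_inr {m n N : ℕ} {i : Fin m} (e : Graft i n N) (x : Fin N → A)
    (j : {x : Fin m // x ≠ i}) (a : A) :
    (fun y => Function.update x (e (Sum.inl j)) a (e (Sum.inr y))) =
      fun y => x (e (Sum.inr y)) := by
  funext y; simp

theorem Graft.update_inr_comp_inr {m n N : ℕ} {i : Fin m} (e : Graft i n N) (x : Fin N → A)
    (j : Fin n) (a : A) :
    (fun y => Function.update x (e (Sum.inr j)) a (e (Sum.inr y))) =
      Function.update (fun y => x (e (Sum.inr y))) j a := by
  funext y
  by_cases h : y = j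
  · subst h; simp
  · simp [h]

variable [AddCommGroup A] [Module k A]

/-- The multilinear map `f ∘ᵢ g`, with inputs labelled by `e`. -/
def graftMap {m n N : ℕ} (i : Fin m) (e : Graft i n N)
    (f : MultilinearMap k (fun _ : Fin m => A) A) (g : MultilinearMap k (fun _ : Fin n => A) A) :
    MultilinearMap k (fun _ : Fin N => A) A where
  toFun x := f (e.args x (g fun y => x (e (Sum.inr y))))
  map_update_add' := by
    intro inst x c a b
    have hi : inst = instDecidableEqFin N := Subsingleton.elim _ _
    subst hi
    obtain ⟨s, rfl⟩ := e.surjective c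
    rcases s with j | j
    · simp only [Graft.args_update_inl, Graft.update_inl_comp_inr, MultilinearMap.map_update_add]
    · simp only [Graft.args_update_inr, Graft.update_inr_comp_inr, MultilinearMap.map_update_add]
      rw [Graft.args_eq_update, MultilinearMap.map_update_add, ← Graft.args_eq_update,
        ← Graft.args_eq_update]
  map_update_smul' := by
    intro inst x c a b
    have hi : inst = instDecidableEqFin N := Subsingleton.elim _ _
    subst hi
    obtain ⟨s, rfl⟩ := e.surjective c
    rcases s with j | j
    · simp only [Graft.args_update_inl, Graft.update_inl_comp_inr, MultilinearMap.map_update_smul]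
    · simp only [Graft.args_update_inr, Graft.update_inr_comp_inr, MultilinearMap.map_update_smul]
      rw [Graft.args_eq_update, MultilinearMap.map_update_smul, ← Graft.args_eq_update]

/-- The operation `f ∘ᵢ g` as a bilinear map. -/
def graftLin {m n N : ℕ} (i : Fin m) (e : Graft i n N) :
    MultilinearMap k (fun _ : Fin m => A) A →ₗ[k] MultilinearMap k (fun _ : Fin n => A) A →ₗ[k]
      MultilinearMap k (fun _ : Fin N => A) A :=
  LinearMap.mk₂ k (graftMap i e)
    (fun _ _ _ => rfl) (fun _ _ _ => rfl)
    (fun f g g' => by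
      refine MultilinearMap.ext fun x => ?_
      change f (e.args x (g _ + g' _)) = f (e.args x (g _)) + f (e.args x (g' _))
      rw [Graft.args_eq_update, MultilinearMap.map_update_add, ← Graft.args_eq_update,
        ← Graft.args_eq_update])
    (fun c f g => by
      refine MultilinearMap.ext fun x => ?_
      change f (e.args x (c • g _)) = c • f (e.args x (g _))
      rw [Graft.args_eq_update, MultilinearMap.map_update_smul, ← Graft.args_eq_update])

variable (k A)

/-- The endomorphism operad of a vector space `A`. -/
def endOperad : Operad k where
  obj n := MultilinearMap k (fun _ : Fin n => A) A
  relabel σ :=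
    { toFun := fun f => f.domDomCongr σ
      map_add' := fun _ _ => rfl
      map_smul' := fun _ _ => rfl }
  comp i e := graftLin i e
  one := MultilinearMap.ofSubsingleton k A A (0 : Fin 1) LinearMap.id
  relabel_refl _ := rfl
  relabel_trans _ _ _ := rfl
  relabel_comp _ _ _ _ _ := rfl
  comp_relabel i σ τ e e' h h' p q := by
    refine MultilinearMap.ext fun x => ?_
    change p (fun j => e'.args x (q fun y => x (e' (Sum.inr (τ y)))) (σ j)) =
      p (e.args x (q fun y => x (e (Sum.inr y))))
    congr 1
    funext j
    by_cases hj : j = i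
    · subst hj; simp [Graft.args, h']
    · have := h ⟨j, hj⟩
      simp only at this
      simp [Graft.args, hj, this]
  comp_one i e σ h h' p := by
    refine MultilinearMap.ext fun x => ?_
    change p (e.args x (x (e (Sum.inr 0)))) = p (fun j => x (σ j))
    congr 1
    funext j
    by_cases hj : j = i
    · subst hj; simp [Graft.args, h']
    · simp [Graft.args, hj, ← h ⟨j, hj⟩]
  one_comp i e σ h q := by
    refine MultilinearMap.ext fun x => ?_
    obtain rfl : i = 0 := Subsingleton.elim _ _
    change e.args x (q fun y => x (e (Sum.inr y))) 0 = q (fun j => x (σ j))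
    simp [Graft.args, h]
  comp_comp i j e e' f f' h₁ h₂ h₃ p q r := by
    refine MultilinearMap.ext fun x => ?_
    change p (e.args (e'.args x (r fun y => x (e' (Sum.inr y))))
        (q fun y => e'.args x (r fun y => x (e' (Sum.inr y))) (e (Sum.inr y)))) =
      p (f'.args x (q (f.args (fun y => x (f' (Sum.inr y)))
        (r fun z => x (f' (Sum.inr (f (Sum.inr z))))))))
    congr 1
    funext c
    by_cases hc : c = i
    · simp only [Graft.args, hc, dite_true]
      congr 1
      funext y
      by_cases hy : y = j
      · subst hy; simp [Graft.args, h₃]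
      · have := h₂ ⟨y, hy⟩
        simp only at this
        simp [Graft.args, hy, this]
    · simp [Graft.args, hc, h₁ ⟨c, hc⟩]
  comp_comm i j hij e e' f f' h₁ h₂ h₃ p q r := by
    refine MultilinearMap.ext fun x => ?_
    change p (e.args (e'.args x (r fun y => x (e' (Sum.inr y))))
        (q fun y => e'.args x (r fun y => x (e' (Sum.inr y))) (e (Sum.inr y)))) =
      p (f.args (f'.args x (q fun y => x (f' (Sum.inr y))))
        (r fun y => f'.args x (q fun y => x (f' (Sum.inr y))) (f (Sum.inr y))))
    congr 1
    funext c
    by_cases hc : c = i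
    · subst hc
      simp [Graft.args, hij, h₂]
    · by_cases hcj : c = j
      · subst hcj
        simp [Graft.args, hc, h₃]
      · simp [Graft.args, hc, hcj, h₁ c hc hcj]

end EndOperad

/-- Algebras over the operad `P`: a vector space `A` with a morphism of operads `P → End_A`. -/
structure Operad.Alg {k : Type u} [Field k] (P : Operad k) where
  carrier : Type u
  [addCommGroup : AddCommGroup carrier]
  [module : Module k carrier]
  act : P.Hom (endOperad k carrier)

attribute [instance] Operad.Alg.addCommGroup Operad.Alg.module

/-! ### Free operads, operadic ideals and quotients -/

/-- Formal expressions, with `n` inputs, in binary generators `e : E`, the operations of an operad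
and linear combinations. -/
inductive FreeTerm (k E : Type u) : ℕ → Type u
  | zero {n : ℕ} : FreeTerm k E n
  | add {n : ℕ} (s t : FreeTerm k E n) : FreeTerm k E n
  | smul {n : ℕ} (c : k) (t : FreeTerm k E n) : FreeTerm k E n
  | gen (e : E) : FreeTerm k E 2
  | one : FreeTerm k E 1
  | relabel {m n : ℕ} (σ : Fin m ≃ Fin n) (t : FreeTerm k E m) : FreeTerm k E n
  | comp {m n N : ℕ} (i : Fin m) (e : Graft i n N) (s : FreeTerm k E m) (t : FreeTerm k E n) :
      FreeTerm k E N

section FreeOperad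

variable {k : Type u} [Field k] {E : Type u} [AddCommGroup E] [Module k E]

open FreeTerm Sum in
/-- The identities that hold between expressions in any operad in which the binary generators
depend linearly on `e : E`, with the transposition acting on them through `τ : E → E`. -/
inductive FreeTerm.Rel (τ : E →ₗ[k] E) :
    ∀ {n : ℕ}, FreeTerm k E n → FreeTerm k E n → Prop
  -- congruence
  | add_left {n : ℕ} {s s' : FreeTerm k E n} (t : FreeTerm k E n) :
      Rel τ s s' → Rel τ (add s t) (add s' t)
  | add_right {n : ℕ} (s : FreeTerm k E n) {t t' : FreeTerm k E n} :
      Rel τ t t' → Rel τ (add s t) (add s t')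
  | smul_congr {n : ℕ} (c : k) {t t' : FreeTerm k E n} :
      Rel τ t t' → Rel τ (smul c t) (smul c t')
  | relabel_congr {m n : ℕ} (σ : Fin m ≃ Fin n) {t t' : FreeTerm k E m} :
      Rel τ t t' → Rel τ (relabel σ t) (relabel σ t')
  | comp_left {m n N : ℕ} (i : Fin m) (e : Graft i n N) {s s' : FreeTerm k E m}
      (t : FreeTerm k E n) : Rel τ s s' → Rel τ (comp i e s t) (comp i e s' t)
  | comp_right {m n N : ℕ} (i : Fin m) (e : Graft i n N) (s : FreeTerm k E m)
      {t t' : FreeTerm k E n} : Rel τ t t' → Rel τ (comp i e s t) (comp i e s t')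
  -- vector space axioms
  | add_assoc {n : ℕ} (s t r : FreeTerm k E n) : Rel τ (add (add s t) r) (add s (add t r))
  | add_comm {n : ℕ} (s t : FreeTerm k E n) : Rel τ (add s t) (add t s)
  | zero_add {n : ℕ} (t : FreeTerm k E n) : Rel τ (add zero t) t
  | smul_add {n : ℕ} (c : k) (s t : FreeTerm k E n) :
      Rel τ (smul c (add s t)) (add (smul c s) (smul c t))
  | add_smul {n : ℕ} (c d : k) (t : FreeTerm k E n) :
      Rel τ (smul (c + d) t) (add (smul c t) (smul d t))
  | mul_smul {n : ℕ} (c d : k) (t : FreeTerm k E n) :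
      Rel τ (smul (c * d) t) (smul c (smul d t))
  | one_smul {n : ℕ} (t : FreeTerm k E n) : Rel τ (smul 1 t) t
  | zero_smul {n : ℕ} (t : FreeTerm k E n) : Rel τ (smul 0 t) zero
  -- linearity of the operations
  | relabel_add {m n : ℕ} (σ : Fin m ≃ Fin n) (s t : FreeTerm k E m) :
      Rel τ (relabel σ (add s t)) (add (relabel σ s) (relabel σ t))
  | relabel_smul {m n : ℕ} (σ : Fin m ≃ Fin n) (c : k) (t : FreeTerm k E m) :
      Rel τ (relabel σ (smul c t)) (smul c (relabel σ t))
  | comp_add_left {m n N : ℕ} (i : Fin m) (e : Graft i n N) (s s' : FreeTerm k E m)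
      (t : FreeTerm k E n) :
      Rel τ (comp i e (add s s') t) (add (comp i e s t) (comp i e s' t))
  | comp_smul_left {m n N : ℕ} (i : Fin m) (e : Graft i n N) (c : k) (s : FreeTerm k E m)
      (t : FreeTerm k E n) : Rel τ (comp i e (smul c s) t) (smul c (comp i e s t))
  | comp_add_right {m n N : ℕ} (i : Fin m) (e : Graft i n N) (s : FreeTerm k E m)
      (t t' : FreeTerm k E n) :
      Rel τ (comp i e s (add t t')) (add (comp i e s t) (comp i e s t'))
  | comp_smul_right {m n N : ℕ} (i : Fin m) (e : Graft i n N) (c : k) (s : FreeTerm k E m)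
      (t : FreeTerm k E n) : Rel τ (comp i e s (smul c t)) (smul c (comp i e s t))
  -- generators
  | gen_add (e f : E) : Rel τ (gen (e + f)) (add (gen e) (gen f))
  | gen_smul (c : k) (e : E) : Rel τ (gen (c • e)) (smul c (gen e))
  | gen_swap (e : E) : Rel τ (gen (τ e)) (relabel (Equiv.swap 0 1) (gen e))
  -- operad axioms
  | relabel_refl {n : ℕ} (p : FreeTerm k E n) : Rel τ (relabel (Equiv.refl (Fin n)) p) p
  | relabel_trans {l m n : ℕ} (σ : Fin l ≃ Fin m) (ρ : Fin m ≃ Fin n) (p : FreeTerm k E l) :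
      Rel τ (relabel ρ (relabel σ p)) (relabel (σ.trans ρ) p)
  | relabel_comp {m n N M : ℕ} (i : Fin m) (e : Graft i n N) (ρ : Fin N ≃ Fin M)
      (p : FreeTerm k E m) (q : FreeTerm k E n) :
      Rel τ (relabel ρ (comp i e p q)) (comp i (e.trans ρ) p q)
  | comp_relabel {m m' n n' N : ℕ} (i : Fin m) (σ : Fin m ≃ Fin m') (ρ : Fin n ≃ Fin n')
      (e : Graft i n N) (e' : Graft (σ i) n' N)
      (h : ∀ x : {x : Fin m // x ≠ i},
        e' (inl ⟨σ x, fun h => x.2 (σ.injective h)⟩) = e (inl x))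
      (h' : ∀ y : Fin n, e' (inr (ρ y)) = e (inr y))
      (p : FreeTerm k E m) (q : FreeTerm k E n) :
      Rel τ (comp (σ i) e' (relabel σ p) (relabel ρ q)) (comp i e p q)
  | comp_one {m N : ℕ} (i : Fin m) (e : Graft i 1 N) (σ : Fin m ≃ Fin N)
      (h : ∀ x : {x : Fin m // x ≠ i}, σ x = e (inl x)) (h' : σ i = e (inr 0))
      (p : FreeTerm k E m) : Rel τ (comp i e p one) (relabel σ p)
  | one_comp {n N : ℕ} (i : Fin 1) (e : Graft i n N) (σ : Fin n ≃ Fin N)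
      (h : ∀ y : Fin n, σ y = e (inr y)) (q : FreeTerm k E n) :
      Rel τ (comp i e one q) (relabel σ q)
  | comp_comp {m n l N M L : ℕ} (i : Fin m) (j : Fin n)
      (e : Graft i n N) (e' : Graft (e (inr j)) l L) (f : Graft j l M) (f' : Graft i M L)
      (h₁ : ∀ x : {x : Fin m // x ≠ i},
        e' (inl ⟨e (inl x), fun h => inl_ne_inr (e.injective h)⟩) = f' (inl x))
      (h₂ : ∀ y : {y : Fin n // y ≠ j},
        e' (inl ⟨e (inr y), fun h => y.2 (inr_injective (e.injective h))⟩) =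
          f' (inr (f (inl y))))
      (h₃ : ∀ z : Fin l, e' (inr z) = f' (inr (f (inr z))))
      (p : FreeTerm k E m) (q : FreeTerm k E n) (r : FreeTerm k E l) :
      Rel τ (comp (e (inr j)) e' (comp i e p q) r) (comp i f' p (comp j f q r))
  | comp_comm {m n l N M L : ℕ} (i j : Fin m) (hij : i ≠ j)
      (e : Graft i n N) (e' : Graft (e (inl ⟨j, hij.symm⟩)) l L)
      (f : Graft j l M) (f' : Graft (f (inl ⟨i, hij⟩)) n L)
      (h₁ : ∀ (x : Fin m) (hi : x ≠ i) (hj : x ≠ j),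
        e' (inl ⟨e (inl ⟨x, hi⟩),
          fun h => hj (congrArg Subtype.val (inl_injective (e.injective h)))⟩) =
        f' (inl ⟨f (inl ⟨x, hj⟩),
          fun h => hi (congrArg Subtype.val (inl_injective (f.injective h)))⟩))
      (h₂ : ∀ y : Fin n, e' (inl ⟨e (inr y), fun h => inr_ne_inl (e.injective h)⟩) = f' (inr y))
      (h₃ : ∀ z : Fin l, e' (inr z) = f' (inl ⟨f (inr z), fun h => inr_ne_inl (f.injective h)⟩))
      (p : FreeTerm k E m) (q : FreeTerm k E n) (r : FreeTerm k E l) :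
      Rel τ (comp (e (inl ⟨j, hij.symm⟩)) e' (comp i e p q) r)
        (comp (f (inl ⟨i, hij⟩)) f' (comp j f p r) q)

/-- The space `Γ(E)(n)` of the free operad. -/
def FreeObj (τ : E →ₗ[k] E) (n : ℕ) : Type u := Quot (FreeTerm.Rel τ (n := n))

variable (τ : E →ₗ[k] E)

/-- The class of an expression in the free operad. -/
def FreeObj.mk {n : ℕ} (t : FreeTerm k E n) : FreeObj τ n := Quot.mk _ t

instance (n : ℕ) : Zero (FreeObj τ n) := ⟨FreeObj.mk τ .zero⟩

instance (n : ℕ) : Add (FreeObj τ n) :=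
  ⟨Quot.map₂ FreeTerm.add (fun s _ _ h => .add_right s h) (fun _ _ t h => .add_left t h)⟩

instance (n : ℕ) : SMul k (FreeObj τ n) := ⟨fun c => Quot.map (.smul c) fun _ _ h => .smul_congr c h⟩

instance (n : ℕ) : Neg (FreeObj τ n) := ⟨fun x => (-1 : k) • x⟩

theorem FreeObj.one_smul' {n : ℕ} (x : FreeObj τ n) : (1 : k) • x = x :=
  Quot.inductionOn x fun t => Quot.sound (.one_smul t)

theorem FreeObj.add_smul' {n : ℕ} (c d : k) (x : FreeObj τ n) : (c + d) • x = c • x + d • x :=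
  Quot.inductionOn x fun t => Quot.sound (.add_smul c d t)

theorem FreeObj.zero_smul' {n : ℕ} (x : FreeObj τ n) : (0 : k) • x = 0 :=
  Quot.inductionOn x fun t => Quot.sound (.zero_smul t)

theorem FreeObj.add_comm' {n : ℕ} (x y : FreeObj τ n) : x + y = y + x :=
  Quot.induction_on₂ x y fun s t => Quot.sound (.add_comm s t)

theorem FreeObj.zero_add' {n : ℕ} (x : FreeObj τ n) : 0 + x = x :=
  Quot.inductionOn x fun t => Quot.sound (.zero_add t)

instance (n : ℕ) : AddCommGroup (FreeObj τ n) where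
  add_assoc x y z := Quot.induction_on₃ x y z fun s t r => Quot.sound (.add_assoc s t r)
  zero_add := FreeObj.zero_add' τ
  add_zero x := by rw [FreeObj.add_comm', FreeObj.zero_add']
  add_comm := FreeObj.add_comm' τ
  neg_add_cancel x := by
    change (-1 : k) • x + x = 0
    conv_lhs => rw [← FreeObj.one_smul' τ x]
    rw [FreeObj.one_smul']
    conv_lhs => arg 2; rw [← FreeObj.one_smul' τ x]
    rw [← FreeObj.add_smul', neg_add_cancel, FreeObj.zero_smul']
  nsmul := nsmulRec
  zsmul := zsmulRec

instance (n : ℕ) : Module k (FreeObj τ n) where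
  one_smul := FreeObj.one_smul' τ
  mul_smul c d x := Quot.inductionOn x fun t => Quot.sound (.mul_smul c d t)
  add_smul := FreeObj.add_smul' τ
  smul_add c x y := Quot.induction_on₂ x y fun s t => Quot.sound (.smul_add c s t)
  zero_smul := FreeObj.zero_smul' τ
  smul_zero c := by
    rw [← FreeObj.zero_smul' τ (0 : FreeObj τ n)]
    refine (Quot.sound (.mul_smul c 0 .zero)).symm.trans ?_
    change (c * 0) • (0 : FreeObj τ n) = _
    rw [mul_zero]

/-- The free operad `Γ(E)` generated by the space `E` of binary operations, on which the symmetric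
group `Σ₂` acts through the involution `τ`. -/
def freeOperad : Operad k where
  obj := FreeObj τ
  relabel σ :=
    { toFun := Quot.map (.relabel σ) fun _ _ h => .relabel_congr σ h
      map_add' := fun x y =>
        Quot.induction_on₂ x y fun s t => Quot.sound (.relabel_add σ s t)
      map_smul' := fun c x => Quot.inductionOn x fun t => Quot.sound (.relabel_smul σ c t) }
  comp i e := LinearMap.mk₂ k
    (Quot.map₂ (.comp i e) (fun s _ _ h => .comp_right i e s h) (fun _ _ t h => .comp_left i e t h))
    (fun x y z => Quot.induction_on₃ x y z fun s s' t => Quot.sound (.comp_add_left i e s s' t))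
    (fun c x y => Quot.induction_on₂ x y fun s t => Quot.sound (.comp_smul_left i e c s t))
    (fun x y z => Quot.induction_on₃ x y z fun s t t' => Quot.sound (.comp_add_right i e s t t'))
    (fun c x y => Quot.induction_on₂ x y fun s t => Quot.sound (.comp_smul_right i e c s t))
  one := FreeObj.mk τ .one
  relabel_refl p := Quot.inductionOn p fun t => Quot.sound (.relabel_refl t)
  relabel_trans σ ρ p := Quot.inductionOn p fun t => Quot.sound (.relabel_trans σ ρ t)
  relabel_comp i e ρ p q := Quot.induction_on₂ p q fun s t => Quot.sound (.relabel_comp i e ρ s t)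
  comp_relabel i σ ρ e e' h h' p q :=
    Quot.induction_on₂ p q fun s t => Quot.sound (.comp_relabel i σ ρ e e' h h' s t)
  comp_one i e σ h h' p := Quot.inductionOn p fun t => Quot.sound (.comp_one i e σ h h' t)
  one_comp i e σ h q := Quot.inductionOn q fun t => Quot.sound (.one_comp i e σ h t)
  comp_comp i j e e' f f' h₁ h₂ h₃ p q r :=
    Quot.induction_on₃ p q r fun s t u => Quot.sound (.comp_comp i j e e' f f' h₁ h₂ h₃ s t u)
  comp_comm i j hij e e' f f' h₁ h₂ h₃ p q r :=
    Quot.induction_on₃ p q r fun s t u =>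
      Quot.sound (.comp_comm i j hij e e' f f' h₁ h₂ h₃ s t u)

/-- The inclusion of the generators `E → Γ(E)(2)`. -/
def freeGen : E →ₗ[k] (freeOperad τ).obj 2 where
  toFun e := FreeObj.mk τ (.gen e)
  map_add' e f := Quot.sound (.gen_add e f)
  map_smul' c e := Quot.sound (.gen_smul c e)

end FreeOperad

section Quotient

variable {k : Type u} [Field k] (O : Operad k)

/-- Operadic ideals. -/
structure Operad.IsIdeal (J : ∀ n : ℕ, Submodule k (O.obj n)) : Prop where
  relabel_mem : ∀ {m n : ℕ} (σ : Fin m ≃ Fin n) {p : O.obj m}, p ∈ J m → O.relabel σ p ∈ J n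
  comp_left_mem : ∀ {m n N : ℕ} (i : Fin m) (e : Graft i n N) {p : O.obj m} (q : O.obj n),
    p ∈ J m → O.comp i e p q ∈ J N
  comp_right_mem : ∀ {m n N : ℕ} (i : Fin m) (e : Graft i n N) (p : O.obj m) {q : O.obj n},
    q ∈ J n → O.comp i e p q ∈ J N

/-- The operadic ideal generated by a set `R` of ternary operations. -/
def Operad.idealSpan (R : Set (O.obj 3)) (n : ℕ) : Submodule k (O.obj n) :=
  sInf {M | ∃ J : ∀ n : ℕ, Submodule k (O.obj n), O.IsIdeal J ∧ R ⊆ J 3 ∧ M = J n}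

theorem Operad.mem_idealSpan {R : Set (O.obj 3)} {n : ℕ} {p : O.obj n} :
    p ∈ O.idealSpan R n ↔
      ∀ J : ∀ n : ℕ, Submodule k (O.obj n), O.IsIdeal J → R ⊆ J 3 → p ∈ J n := by
  simp only [Operad.idealSpan, Submodule.mem_sInf, Set.mem_ofPred_eq]
  constructor
  · intro h J hJ hR
    exact h _ ⟨J, hJ, hR, rfl⟩
  · rintro h _ ⟨J, hJ, hR, rfl⟩
    exact h J hJ hR

theorem Operad.isIdeal_idealSpan (R : Set (O.obj 3)) : O.IsIdeal (O.idealSpan R) where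
  relabel_mem σ _ hp := (O.mem_idealSpan).2 fun J hJ hR =>
    hJ.relabel_mem σ ((O.mem_idealSpan).1 hp J hJ hR)
  comp_left_mem i e _ q hp := (O.mem_idealSpan).2 fun J hJ hR =>
    hJ.comp_left_mem i e q ((O.mem_idealSpan).1 hp J hJ hR)
  comp_right_mem i e p _ hq := (O.mem_idealSpan).2 fun J hJ hR =>
    hJ.comp_right_mem i e p ((O.mem_idealSpan).1 hq J hJ hR)

variable {O}

/-- The quotient of an operad by an operadic ideal. -/
def Operad.quotient {J : ∀ n : ℕ, Submodule k (O.obj n)} (hJ : O.IsIdeal J) : Operad k where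
  obj n := O.obj n ⧸ J n
  relabel σ := (J _).mapQ (J _) (O.relabel σ) fun _ hp => hJ.relabel_mem σ hp
  comp i e := (J _).liftQ
    { toFun := fun p => (J _).mapQ (J _) (O.comp i e p) fun _ hq => hJ.comp_right_mem i e p hq
      map_add' := fun p p' => by
        ext q
        simp
      map_smul' := fun c p => by
        ext q
        simp } (fun p hp => by
      ext q
      simpa using (Submodule.Quotient.mk_eq_zero _).2 (hJ.comp_left_mem i e q hp))
  one := Submodule.Quotient.mk O.one
  relabel_refl := by
    rintro n ⟨p⟩
    exact congrArg (Submodule.Quotient.mk (p := J _)) (O.relabel_refl p)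
  relabel_trans := by
    rintro l m n σ τ ⟨p⟩
    exact congrArg (Submodule.Quotient.mk (p := J _)) (O.relabel_trans σ τ p)
  relabel_comp := by
    rintro m n N M i e ρ ⟨p⟩ ⟨q⟩
    exact congrArg (Submodule.Quotient.mk (p := J _)) (O.relabel_comp i e ρ p q)
  comp_relabel := by
    rintro m m' n n' N i σ τ e e' h h' ⟨p⟩ ⟨q⟩
    exact congrArg (Submodule.Quotient.mk (p := J _)) (O.comp_relabel i σ τ e e' h h' p q)
  comp_one := by
    rintro m N i e σ h h' ⟨p⟩
    exact congrArg (Submodule.Quotient.mk (p := J _)) (O.comp_one i e σ h h' p)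
  one_comp := by
    rintro n N i e σ h ⟨q⟩
    exact congrArg (Submodule.Quotient.mk (p := J _)) (O.one_comp i e σ h q)
  comp_comp := by
    rintro m n l N M L i j e e' f f' h₁ h₂ h₃ ⟨p⟩ ⟨q⟩ ⟨r⟩
    exact congrArg (Submodule.Quotient.mk (p := J _)) (O.comp_comp i j e e' f f' h₁ h₂ h₃ p q r)
  comp_comm := by
    rintro m n l N M L i j hij e e' f f' h₁ h₂ h₃ ⟨p⟩ ⟨q⟩ ⟨r⟩
    exact congrArg (Submodule.Quotient.mk (p := J _))
      (O.comp_comm i j hij e e' f f' h₁ h₂ h₃ p q r)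

/-- The projection of an operad onto its quotient. -/
def Operad.toQuotient {J : ∀ n : ℕ, Submodule k (O.obj n)} (hJ : O.IsIdeal J) :
    O.Hom (Operad.quotient hJ) where
  toFun n :=
    { toFun := fun p => (Submodule.Quotient.mk p : O.obj n ⧸ J n)
      map_add' := fun _ _ => rfl
      map_smul' := fun _ _ => rfl }
  map_relabel _ _ := rfl
  map_comp _ _ _ _ := rfl
  map_one := rfl

variable (O)

/-- The quotient `O/(R)` of an operad by the operadic ideal generated by `R ⊆ O(3)`. -/
def Operad.modRel (R : Submodule k (O.obj 3)) : Operad k :=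
  Operad.quotient (O.isIdeal_idealSpan (R : Set (O.obj 3)))

/-- The projection `O → O/(R)`. -/
def Operad.toModRel (R : Submodule k (O.obj 3)) : O.Hom (O.modRel R) :=
  Operad.toQuotient (O.isIdeal_idealSpan (R : Set (O.obj 3)))

end Quotient

/-! ### Quadratic operads and their quadratic duals -/

/-- A presentation `⟨E; R⟩` of a quadratic operad: a finite dimensional space `E` of binary
generators with an action of `Σ₂`, given by the involution `τ`, and a `Σ₃`-stable space `R` of
relations in `Γ(E)(3)`. -/
structure QuadraticData (k : Type u) [Field k] where
  E : Type u
  [addCommGroup : AddCommGroup E]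
  [module : Module k E]
  [finite : FiniteDimensional k E]
  τ : E →ₗ[k] E
  τ_comp_τ : τ ∘ₗ τ = LinearMap.id
  R : Submodule k ((freeOperad τ).obj 3)
  R_stable : ∀ (σ : Equiv.Perm (Fin 3)), ∀ r ∈ R, (freeOperad τ).relabel σ r ∈ R

attribute [instance] QuadraticData.addCommGroup QuadraticData.module QuadraticData.finite

/-- The identification of three copies of `E ⊗ E` with `Γ(E)(3)`: the element `e ⊗ f` of the
summand `u` goes to `(e ∘₁ f) = e(f(x₀, x₁), x₂)` with the inputs renamed by the `u`-th power of
the cyclic permutation. -/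
noncomputable def ternary {k : Type u} [Field k] {E : Type u} [AddCommGroup E] [Module k E]
    (τ : E →ₗ[k] E) : (Fin 3 → E ⊗[k] E) →ₗ[k] (freeOperad τ).obj 3 :=
  ∑ u : Fin 3, (freeOperad τ).relabel ((finRotate 3) ^ u.1) ∘ₗ
    TensorProduct.lift
      (((freeOperad τ).comp (0 : Fin 2) (Graft.std (m := 1) (n := 1) (N := 2) 0 rfl)).compl₁₂
        (freeGen τ) (freeGen τ)) ∘ₗ LinearMap.proj u

namespace QuadraticData

variable {k : Type u} [Field k] (D : QuadraticData k)

/-- The quadratic operad `P = Γ(E)/(R)`. -/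
def operad : Operad k := (freeOperad D.τ).modRel D.R

/-- The generators `E → P(2)`. -/
def gen : D.E →ₗ[k] D.operad.obj 2 :=
  ((freeOperad D.τ).toModRel D.R).toFun 2 ∘ₗ freeGen D.τ

/-- The involution of `E^∨ = E^# ⊗ sgn₂`. -/
def dualτ : Module.Dual k D.E →ₗ[k] Module.Dual k D.E := -Module.Dual.transpose (R := k) D.τ

/-- The space of relations `R^⊥ ⊆ Γ(E^∨)(3)`: the annihilator of `R` under the pairing of
`Γ(E^∨)(3)` with `Γ(E)(3)`, in which the three summands `E^# ⊗ E^#` and `E ⊗ E` are paired in the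
natural way. (All permutations in `ternary` are even, so that no signs appear.) -/
noncomputable def dualR : Submodule k ((freeOperad D.dualτ).obj 3) :=
  Submodule.map (ternary D.dualτ)
    (⨅ x : {x : Fin 3 → D.E ⊗[k] D.E // ternary D.τ x ∈ D.R},
      LinearMap.ker (∑ u : Fin 3,
        (TensorProduct.dualDistrib k D.E D.E).flip (x.1 u) ∘ₗ LinearMap.proj u))

/-- The quadratic dual operad `P^! = Γ(E^∨)/(R^⊥)`. -/
noncomputable def dual : Operad k :=
  (freeOperad D.dualτ).modRel D.dualR

/-- The generators `E^∨ → P^!(2)`. -/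
noncomputable def dualGen : Module.Dual k D.E →ₗ[k] D.dual.obj 2 :=
  ((freeOperad D.dualτ).toModRel D.dualR).toFun 2 ∘ₗ freeGen D.dualτ

/-! ### The operadic cochain complex -/

section Cochains

variable (A : D.operad.Alg)

/-- The `n`-th space of the operad `End_A ⊗ P^!`; with the twist of the action of the symmetric
group by the signum representation, this is `C̃^{n-1}(A; A)`. -/
abbrev Pre (n : ℕ) : Type u := (endOperad k A.carrier).obj n ⊗[k] D.dual.obj n

variable {D}

/-- The relabelling of inputs in `End_A ⊗ P^!`. -/
noncomputable def preRelabel {m n : ℕ} (σ : Fin m ≃ Fin n) : D.Pre A m →ₗ[k] D.Pre A n :=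
  TensorProduct.map ((endOperad k A.carrier).relabel σ) (D.dual.relabel σ)

/-- Partial compositions in `End_A ⊗ P^!`. -/
noncomputable def preComp {m n N : ℕ} (i : Fin m) (e : Graft i n N) :
    D.Pre A m →ₗ[k] D.Pre A n →ₗ[k] D.Pre A N :=
  TensorProduct.map₂ ((endOperad k A.carrier).comp i e) (D.dual.comp i e)

/-- The action of a permutation, twisted by its sign. -/
noncomputable def twist {n : ℕ} (σ : Equiv.Perm (Fin n)) : D.Pre A n →ₗ[k] D.Pre A n :=
  ((Equiv.Perm.sign σ : ℤ) : k) • preRelabel A σ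

/-- The operadic cochains `C^m_P(A; A)`: the invariants of `Σ_{m+1}` in
`Lin(A^{⊗(m+1)}, A) ⊗ P^!(m+1) ⊗ sgn_{m+1}`. -/
noncomputable def Cochain (m : ℕ) : Submodule k (D.Pre A (m + 1)) :=
  ⨅ σ : Equiv.Perm (Fin (m + 1)), LinearMap.ker (twist A σ - LinearMap.id)

variable {A} in
theorem mem_cochain {m : ℕ} {f : D.Pre A (m + 1)} :
    f ∈ Cochain A m ↔ ∀ σ : Equiv.Perm (Fin (m + 1)), twist A σ f = f := by
  simp [Cochain, sub_eq_zero]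

theorem twist_twist {n : ℕ} (σ ρ : Equiv.Perm (Fin n)) (f : D.Pre A n) :
    twist A ρ (twist A σ f) = twist A (ρ * σ) f := by
  have h : preRelabel A ρ ∘ₗ preRelabel A σ = preRelabel (D := D) A (ρ * σ) := by
    refine TensorProduct.ext' fun φ q => ?_
    simp only [preRelabel, LinearMap.comp_apply, TensorProduct.map_tmul, Operad.relabel_trans]
    rfl
  have h' := LinearMap.congr_fun h f
  simp only [LinearMap.comp_apply] at h'
  simp only [twist, LinearMap.smul_apply, map_smul, h', smul_smul, Equiv.Perm.sign_mul,
    Units.val_mul, Int.cast_mul, mul_comm]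

/-- The averaging map, as an endomorphism. -/
noncomputable def averEnd (n : ℕ) : D.Pre A n →ₗ[k] D.Pre A n :=
  (n.factorial : k)⁻¹ • ∑ σ : Equiv.Perm (Fin n), twist A σ

theorem averEnd_mem (m : ℕ) (f : D.Pre A (m + 1)) : averEnd A (m + 1) f ∈ Cochain A m := by
  rw [mem_cochain]
  intro ρ
  simp only [averEnd, LinearMap.smul_apply, LinearMap.sum_apply, map_smul, map_sum, twist_twist]
  congr 1
  exact Fintype.sum_equiv (Equiv.mulLeft ρ) _ _ fun σ => rfl

/-- The averaging map `Aver : C̃^m(A; A) → C^m(A; A)`. -/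
noncomputable def aver (m : ℕ) : D.Pre A (m + 1) →ₗ[k] Cochain A m :=
  (averEnd A (m + 1)).codRestrict (Cochain A m) (averEnd_mem A m)

theorem aver_coe [CharZero k] {m : ℕ} (f : Cochain A m) : aver A m f = f := by
  apply Subtype.ext
  change averEnd A (m + 1) f = f
  have h : ∀ σ, twist A σ (f : D.Pre A (m + 1)) = f := mem_cochain.1 f.2
  simp only [averEnd, LinearMap.smul_apply, LinearMap.sum_apply, h, Finset.sum_const,
    Finset.card_univ, Fintype.card_perm, Fintype.card_fin]
  rw [← Nat.cast_smul_eq_nsmul k, smul_smul, inv_mul_cancel₀, one_smul]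
  exact_mod_cast Nat.factorial_ne_zero _

/-- The pre-Lie product `f ∘ g = ∑ᵢ ± f ∘ᵢ g` of `(End_A ⊗ P^!)_*`. -/
noncomputable def preLie {m n N : ℕ} (hN : m + n = N) :
    D.Pre A (m + 1) →ₗ[k] D.Pre A (n + 1) →ₗ[k] D.Pre A (N + 1) :=
  ∑ i : Fin (m + 1), (-1 : k) ^ (n * i.1) • preComp A i (Graft.std i hN)

/-- The pre-Lie product induced on the invariants. With this normalization, which corresponds to
the identification of coinvariants with invariants by the norm map, it is the composition of
coderivations; for associative algebras it is Gerstenhaber's product of Hochschild cochains. -/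
noncomputable def circ {m n N : ℕ} (hN : m + n = N) :
    D.Pre A (m + 1) →ₗ[k] D.Pre A (n + 1) →ₗ[k] Cochain A N :=
  (((N + 1).factorial : k) / ((m + 1).factorial * (n + 1).factorial)) •
    (preLie A hN).compr₂ (aver A N)

/-- The structure `1`-cochain of the algebra `A`: the image in `End_A(2) ⊗ P^!(2)` of the canonical
element of `P(2) ⊗ P^!(2) = E ⊗ E^#`, that is, of the identity of `E`. -/
noncomputable def chi : D.Pre A 2 :=
  TensorProduct.map (A.act.toFun 2 ∘ₗ D.gen) D.dualGen (coevaluation k D.E 1)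

/-- The differential `d_P f = [χ, f] = χ ∘ f - (-1)^m f ∘ χ` on `C^m_P(A; A)`. -/
noncomputable def diff (m : ℕ) : Cochain A m →ₗ[k] Cochain A (m + 1) :=
  (circ A (m := 1) (n := m) (N := m + 1) (Nat.add_comm 1 m) (chi A) -
    (-1 : k) ^ m • (circ A (m := m) (n := 1) (N := m + 1) rfl).flip (chi A)) ∘ₗ
      (Cochain A m).subtype

end Cochains

end QuadraticData

/-! ### Trees with one white vertex -/

/-- Rooted trees with input legs labelled by elements of `Fin b`, whose white vertices have arity
`a` and whose black vertices are at least binary and decorated by elements of `P`. The inputs of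
every vertex are linearly ordered. A tree is given by what is attached to its root edge. -/
inductive NatTree (P : ℕ → Type u) (a b : ℕ) : Type u
  | leaf (j : Fin b) : NatTree P a b
  | black {r : ℕ} (hr : 2 ≤ r) (p : P r) (c : Fin r → NatTree P a b) : NatTree P a b
  | white (c : Fin a → NatTree P a b) : NatTree P a b

namespace NatTree

section

variable {P : ℕ → Type u} {a b c : ℕ}

/-- The number of legs labelled by `j`. -/
def legs (j : Fin b) : NatTree P a b → ℕ
  | leaf j' => if j' = j then 1 else 0
  | black _ _ c => ∑ i, (c i).legs j
  | white c => ∑ i, (c i).legs j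

/-- The number of white vertices. -/
def whites : NatTree P a b → ℕ
  | leaf _ => 0
  | black _ _ c => ∑ i, (c i).whites
  | white c => 1 + ∑ i, (c i).whites

/-- The trees that define unary operations: there is exactly one white vertex, and the input legs
are labelled bijectively by `Fin b`. -/
def Valid (T : NatTree P a b) : Prop := T.whites = 1 ∧ ∀ j : Fin b, T.legs j = 1

/-- Attaching the tree `g j` to each leg labelled by `j`. -/
def bind (g : Fin b → NatTree P a c) : NatTree P a b → NatTree P a c
  | leaf j => g j
  | black hr p d => black hr p fun i => (d i).bind g
  | white d => white fun i => (d i).bind g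

/-- Inserting the tree `T` into the white vertices of a tree. -/
def insert : NatTree P b c → NatTree P a b → NatTree P a c
  | leaf j, _ => leaf j
  | black hr p d, T => black hr p fun i => (d i).insert T
  | white d, T => T.bind fun i => (d i).insert T

theorem legs_bind (g : Fin b → NatTree P a c) (j : Fin c) (T : NatTree P a b) :
    (T.bind g).legs j = ∑ i, T.legs i * (g i).legs j := by
  induction T with
  | leaf j' => simp [bind, legs]
  | black hr p d ih =>
    simp only [bind, legs, ih, Finset.sum_mul]
    exact Finset.sum_comm
  | white d ih =>
    simp only [bind, legs, ih, Finset.sum_mul]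
    exact Finset.sum_comm

theorem whites_bind (g : Fin b → NatTree P a c) (T : NatTree P a b) :
    (T.bind g).whites = T.whites + ∑ i, T.legs i * (g i).whites := by
  induction T with
  | leaf j' => simp [bind, legs, whites]
  | black hr p d ih =>
    simp only [bind, legs, whites, ih, Finset.sum_mul, Finset.sum_add_distrib]
    rw [Finset.sum_comm]
  | white d ih =>
    simp only [bind, legs, whites, ih, Finset.sum_mul, Finset.sum_add_distrib]
    rw [Finset.sum_comm, add_assoc]

theorem Valid.insert {S : NatTree P b c} (hS : S.Valid) {T : NatTree P a b} (hT : T.Valid) :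
    (S.insert T).Valid := by
  have hl : ∀ (j : Fin c) (S : NatTree P b c), (S.insert T).legs j = S.legs j := by
    intro j S
    induction S with
    | leaf j' => rfl
    | black hr p d ih => simp only [NatTree.insert, legs, ih]
    | white d ih => simp only [NatTree.insert, legs_bind, legs, ih, hT.2, one_mul]
  have hw : ∀ S : NatTree P b c, (S.insert T).whites = S.whites := by
    intro S
    induction S with
    | leaf j' => rfl
    | black hr p d ih => simp only [NatTree.insert, whites, ih]
    | white d ih => simp only [NatTree.insert, whites_bind, whites, ih, hT.1, hT.2, one_mul]
  exact ⟨(hw S).trans hS.1, fun j => (hl j S).trans (hS.2 j)⟩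

/-- Renaming the legs. -/
def rename (σ : Fin b → Fin c) (T : NatTree P a b) : NatTree P a c := T.bind fun j => leaf (σ j)

theorem Valid.rename {T : NatTree P a b} (hT : T.Valid) (σ : Fin b ≃ Fin c) :
    (T.rename σ).Valid := by
  refine ⟨by simp [NatTree.rename, whites_bind, whites, hT.1], fun j => ?_⟩
  obtain ⟨i, rfl⟩ := σ.surjective j
  simp [NatTree.rename, legs_bind, legs, hT.2]

/-- The corolla with one white vertex and no black vertices. -/
def corolla : NatTree P a a := white leaf

theorem valid_corolla : (corolla : NatTree P a a).Valid := by
  simp [corolla, Valid, whites, legs]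

end

section Evaluation

variable {k : Type u} [Field k] {O : Operad k} (A : O.Alg) {a b c : ℕ}

/-- An element of the endomorphism operad, as a multilinear map. -/
abbrev asMap {V : Type u} [AddCommGroup V] [Module k V] {n : ℕ} (f : (endOperad k V).obj n) :
    MultilinearMap k (fun _ : Fin n => V) V := f

/-- The composition along a tree: the white vertices are decorated by `φ`, the black ones by the
operations of the algebra `A`, and the leg `j` carries `x j`. -/
def eval (φ : (endOperad k A.carrier).obj a) (x : Fin b → A.carrier) :
    NatTree O.obj a b → A.carrier
  | leaf j => x j
  | black (r := r) _ p c => asMap (A.act.toFun r p) fun i => (c i).eval φ x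
  | white c => asMap φ fun i => (c i).eval φ x

/-- A map that is constant if `d = 0` and linear if `d = 1`. -/
def HasDeg {M N : Type u} [AddCommGroup M] [Module k M] [AddCommGroup N] [Module k N] (d : ℕ)
    (F : M → N) : Prop :=
  (d = 0 → ∀ v w, F v = F w) ∧ (d = 1 → IsLinearMap k F)

theorem HasDeg.comp {M N : Type u} [AddCommGroup M] [Module k M] [AddCommGroup N] [Module k N]
    {r : ℕ} (g : MultilinearMap k (fun _ : Fin r => N) N) (d : Fin r → ℕ) (F : Fin r → M → N)
    (hF : ∀ i, HasDeg (k := k) (d i) (F i)) :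
    HasDeg (k := k) (∑ i, d i) fun v => g fun i => F i v := by
  constructor
  · intro h v w
    rw [Finset.sum_eq_zero_iff] at h
    exact congrArg g (funext fun i => (hF i).1 (h i (Finset.mem_univ i)) v w)
  · intro h
    obtain ⟨i, hi, h0⟩ : ∃ i, d i = 1 ∧ ∀ j, j ≠ i → d j = 0 := by
      obtain ⟨i, hi⟩ : ∃ i, d i ≠ 0 := by
        by_contra hc
        push Not at hc
        simp [hc] at h
      have hs := Finset.add_sum_erase Finset.univ d (Finset.mem_univ i)
      refine ⟨i, by omega, fun j hj => ?_⟩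
      have := Finset.single_le_sum (f := d) (fun _ _ => Nat.zero_le _)
        (Finset.mem_erase.2 ⟨hj, Finset.mem_univ j⟩)
      omega
    have hupd : ∀ v, (fun j => F j v) = Function.update (fun j => F j 0) i (F i v) := by
      intro v
      funext j
      by_cases hj : j = i
      · subst hj; simp
      · rw [Function.update_of_ne hj]
        exact (hF j).1 (h0 j hj) v 0
    have hlin := (hF i).2 hi
    constructor
    · intro v w
      rw [hupd (v + w), hupd v, hupd w, hlin.map_add, g.map_update_add]
    · intro t v
      rw [hupd (t • v), hupd v, hlin.map_smul, g.map_update_smul]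

theorem hasDeg_eval_leg (φ : (endOperad k A.carrier).obj a) (x : Fin b → A.carrier) (j : Fin b)
    (T : NatTree O.obj a b) :
    HasDeg (k := k) (T.legs j) fun v : A.carrier => T.eval A φ (Function.update x j v) := by
  induction T with
  | leaf j' =>
    by_cases h : j' = j
    · subst h
      simp only [legs, eval, Function.update_self, if_true]
      exact ⟨fun h => absurd h one_ne_zero, fun _ => ⟨fun _ _ => rfl, fun _ _ => rfl⟩⟩
    · simp only [legs, eval, Function.update_of_ne h, h, if_false]
      exact ⟨fun _ _ _ => rfl, fun h => absurd h zero_ne_one⟩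
  | black hr p d ih => exact HasDeg.comp (asMap (A.act.toFun _ p)) _ _ ih
  | white d ih => exact HasDeg.comp (asMap φ) _ _ ih

theorem hasDeg_eval_white (x : Fin b → A.carrier) (T : NatTree O.obj a b) :
    HasDeg (k := k) T.whites fun φ : (endOperad k A.carrier).obj a => T.eval A φ x := by
  induction T with
  | leaf j' => exact ⟨fun _ _ _ => rfl, fun h => absurd h zero_ne_one⟩
  | black hr p d ih => exact HasDeg.comp (asMap (A.act.toFun _ p)) _ _ ih
  | white d ih =>
    refine ⟨fun h => by simp [whites] at h, fun h => ?_⟩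
    have h0 : ∀ i, (d i).whites = 0 := by
      intro i
      have : ∑ i, (d i).whites = 0 := by simp only [whites] at h; omega
      exact Finset.sum_eq_zero_iff.1 this i (Finset.mem_univ i)
    have hc : ∀ φ : (endOperad k A.carrier).obj a,
        (fun i => (d i).eval A φ x) = fun i => (d i).eval A 0 x :=
      fun φ => funext fun i => (ih i).1 (h0 i) φ 0
    constructor
    · intro φ ψ
      simp only [eval]
      rw [hc (φ + ψ), hc φ, hc ψ]
      rfl
    · intro t φ
      simp only [eval]
      rw [hc (t • φ), hc φ]
      rfl

/-- The linear map `Lin(A^{⊗a}, A) → Lin(A^{⊗b}, A)` given by the composition along a tree with one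
white vertex. -/
def op (T : NatTree O.obj a b) (hT : T.Valid) :
    (endOperad k A.carrier).obj a →ₗ[k] (endOperad k A.carrier).obj b where
  toFun φ :=
    { toFun := fun x => T.eval A φ x
      map_update_add' := by
        intro inst x j v w
        have hi : inst = instDecidableEqFin b := Subsingleton.elim _ _
        subst hi
        exact ((hasDeg_eval_leg A φ x j T).2 (hT.2 j)).map_add v w
      map_update_smul' := by
        intro inst x j t v
        have hi : inst = instDecidableEqFin b := Subsingleton.elim _ _
        subst hi
        exact ((hasDeg_eval_leg A φ x j T).2 (hT.2 j)).map_smul t v }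
  map_add' φ ψ := MultilinearMap.ext fun x => ((hasDeg_eval_white A x T).2 hT.1).map_add φ ψ
  map_smul' t φ := MultilinearMap.ext fun x => ((hasDeg_eval_white A x T).2 hT.1).map_smul t φ

theorem eval_bind (g : Fin b → NatTree O.obj a c) (φ : (endOperad k A.carrier).obj a)
    (x : Fin c → A.carrier) (T : NatTree O.obj a b) :
    (T.bind g).eval A φ x = T.eval A φ fun i => (g i).eval A φ x := by
  induction T with
  | leaf j => rfl
  | black hr p d ih => simp only [bind, eval, ih]
  | white d ih => simp only [bind, eval, ih]

theorem op_insert (T : NatTree O.obj a b) (hT : T.Valid) (S : NatTree O.obj b c) (hS : S.Valid)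
    (φ : (endOperad k A.carrier).obj a) :
    (S.insert T).op A (hS.insert hT) φ = S.op A hS (T.op A hT φ) := by
  refine MultilinearMap.ext fun x => ?_
  change (S.insert T).eval A φ x = S.eval A (T.op A hT φ) x
  clear hS
  induction S with
  | leaf j => rfl
  | black hr p d ih => simp only [NatTree.insert, eval, ih]
  | white d ih =>
    simp only [NatTree.insert, eval, eval_bind, ih]
    rfl

theorem op_rename (T : NatTree O.obj a b) (hT : T.Valid) (σ : Fin b ≃ Fin c)
    (φ : (endOperad k A.carrier).obj a) :
    (T.rename σ).op A (hT.rename σ) φ = (endOperad k A.carrier).relabel σ (T.op A hT φ) := by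
  refine MultilinearMap.ext fun x => ?_
  exact eval_bind A _ φ x T

theorem op_corolla (φ : (endOperad k A.carrier).obj a) :
    (corolla : NatTree O.obj a a).op A valid_corolla φ = φ :=
  MultilinearMap.ext fun x => by
    change (corolla : NatTree O.obj a a).eval A φ x = asMap φ x
    simp only [corolla, eval]

end Evaluation

end NatTree

/-! ### Natural operations -/

namespace QuadraticData

variable {k : Type u} [Field k] (D : QuadraticData k)

/-- Families of linear maps `C^m_P(A; A) → C^{m'}_P(A; A)`, one for each `P`-algebra `A`. -/
abbrev Family (m m' : ℕ) : Type (u + 1) :=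
  ∀ A : D.operad.Alg, Cochain A m →ₗ[k] Cochain A m'

variable {D}

/-- The natural operation `U_{(T, Φ)}`. -/
noncomputable def treeOperation {m m' : ℕ} (T : NatTree D.operad.obj (m + 1) (m' + 1))
    (hT : T.Valid) (Φ : D.dual.obj (m + 1) →ₗ[k] D.dual.obj (m' + 1)) : D.Family m m' :=
  fun A => aver A m' ∘ₗ TensorProduct.map (T.op A hT) Φ ∘ₗ (Cochain A m).subtype

variable (D)

/-- The natural unary operations `C^m_P(A; A) → C^{m'}_P(A; A)`: the linear span of the operations
`U_{(T, Φ)}`. -/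
noncomputable def natural (m m' : ℕ) : Submodule k (D.Family m m') :=
  Submodule.span k {U | ∃ (T : NatTree D.operad.obj (m + 1) (m' + 1)) (hT : T.Valid)
    (Φ : D.dual.obj (m + 1) →ₗ[k] D.dual.obj (m' + 1)), U = treeOperation T hT Φ}

variable {D}

theorem natural_comp {l m n : ℕ} {V : D.Family m n} {U : D.Family l m}
    (hV : V ∈ D.natural m n) (hU : U ∈ D.natural l m) :
    (fun A => V A ∘ₗ U A) ∈ D.natural l n := by
  induction hV using Submodule.span_induction with
  | zero =>
    convert (D.natural l n).zero_mem using 1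
    funext A
    exact LinearMap.zero_comp _
  | add V V' _ _ h h' => exact (D.natural l n).add_mem h h'
  | smul t V _ h => exact (D.natural l n).smul_mem t h
  | mem V hV =>
    obtain ⟨S, hS, Ψ, rfl⟩ := hV
    induction hU using Submodule.span_induction with
    | zero =>
      convert (D.natural l n).zero_mem using 1
      funext A
      exact LinearMap.comp_zero _
    | add U U' _ _ h h' =>
      convert (D.natural l n).add_mem h h' using 1
      funext A
      exact LinearMap.comp_add _ _ _
    | smul t U _ h =>
      convert (D.natural l n).smul_mem t h using 1
      funext A
      exact LinearMap.comp_smul _ _ _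
    | mem U hU =>
      obtain ⟨T, hT, Φ, rfl⟩ := hU
      have key : (fun A => treeOperation S hS Ψ A ∘ₗ treeOperation T hT Φ A) =
          ((m + 1).factorial : k)⁻¹ • ∑ σ : Equiv.Perm (Fin (m + 1)),
            ((Equiv.Perm.sign σ : ℤ) : k) •
              treeOperation (D := D) (S.insert (T.rename σ)) (hS.insert (hT.rename σ))
                (Ψ ∘ₗ D.dual.relabel σ ∘ₗ Φ) := by
        funext A
        have hσ : ∀ σ : Equiv.Perm (Fin (m + 1)),
            TensorProduct.map ((S.insert (T.rename σ)).op A (hS.insert (hT.rename σ)))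
              (Ψ ∘ₗ D.dual.relabel σ ∘ₗ Φ) =
            TensorProduct.map (S.op A hS) Ψ ∘ₗ preRelabel A σ ∘ₗ
              TensorProduct.map (T.op A hT) Φ := by
          intro σ
          refine TensorProduct.ext' fun φ q => ?_
          simp only [preRelabel, LinearMap.comp_apply, TensorProduct.map_tmul]
          rw [NatTree.op_insert A (T.rename σ) (hT.rename σ) S hS, NatTree.op_rename A T hT σ]
        refine LinearMap.ext fun f => ?_
        simp only [Pi.smul_apply, Finset.sum_apply, treeOperation, hσ, LinearMap.smul_apply,
          LinearMap.sum_apply, LinearMap.comp_apply]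
        change aver A n (TensorProduct.map (S.op A hS) Ψ (averEnd A (m + 1) _)) = _
        simp only [averEnd, twist, LinearMap.smul_apply, LinearMap.sum_apply, map_smul, map_sum]
      rw [key]
      refine (D.natural l n).smul_mem _ (Submodule.sum_mem _ fun σ _ => ?_)
      exact (D.natural l n).smul_mem _ (Submodule.subset_span ⟨_, _, _, rfl⟩)

theorem natural_id [CharZero k] (m : ℕ) :
    (fun _ => LinearMap.id : D.Family m m) ∈ D.natural m m := by
  refine Submodule.subset_span ⟨NatTree.corolla, NatTree.valid_corolla, LinearMap.id, ?_⟩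
  funext A
  refine LinearMap.ext fun f => ?_
  have h : (NatTree.corolla : NatTree D.operad.obj (m + 1) (m + 1)).op A NatTree.valid_corolla =
      LinearMap.id := LinearMap.ext fun φ => NatTree.op_corolla A φ
  simp only [treeOperation, h, TensorProduct.map_id, LinearMap.comp_apply, LinearMap.id_apply]
  exact (aver_coe A f).symm

variable (D)

/-- The cochain complex `C^*_P(A; A) = ⨁ C^m_P(A; A)`, as a graded vector space. -/
def Total (A : D.operad.Alg) : Type u := ⨁ m : ℕ, Cochain A m

noncomputable instance (A : D.operad.Alg) : AddCommGroup (D.Total A) :=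
  inferInstanceAs (AddCommGroup (⨁ m : ℕ, Cochain A m))

noncomputable instance (A : D.operad.Alg) : Module k (D.Total A) :=
  inferInstanceAs (Module k (⨁ m : ℕ, Cochain A m))

variable {D}

/-- The inclusion of `C^m_P(A; A)`. -/
noncomputable def incl (A : D.operad.Alg) (m : ℕ) : Cochain A m →ₗ[k] D.Total A :=
  DirectSum.lof k ℕ (fun m => Cochain A m) m

/-- The projection onto `C^m_P(A; A)`. -/
noncomputable def projection (A : D.operad.Alg) (m : ℕ) : D.Total A →ₗ[k] Cochain A m :=
  DirectSum.component k ℕ (fun m => Cochain A m) m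

theorem projection_incl (A : D.operad.Alg) (m : ℕ) (f : Cochain A m) :
    projection A m (incl A m f) = f :=
  DirectSum.component.lof_self (R := k) (M := fun m => Cochain A m) m f

theorem projection_incl_ne (A : D.operad.Alg) {m m' : ℕ} (h : m ≠ m') (f : Cochain A m) :
    projection A m' (incl A m f) = 0 :=
  (DirectSum.component.of (R := k) (M := fun m => Cochain A m) m' m f).trans (dif_neg h)

theorem total_ext (A : D.operad.Alg) {x y : D.Total A}
    (h : ∀ m, projection A m x = projection A m y) : x = y :=
  DirectSum.ext_component k h

variable (D)

/-- The algebra of all families of linear maps `C^*_P(A; A) → C^*_P(A; A)`, one for each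
`P`-algebra `A`, under composition. -/
abbrev Ambient : Type (u + 1) := ∀ A : D.operad.Alg, Module.End k (D.Total A)

/-- The component `C^m_P(A; A) → C^{m'}_P(A; A)` of a family. -/
noncomputable def component (m m' : ℕ) : D.Ambient →ₗ[k] D.Family m m' where
  toFun U A := projection A m' ∘ₗ U A ∘ₗ incl A m
  map_add' U V := by
    funext A
    refine LinearMap.ext fun f => ?_
    simp
  map_smul' t U := by
    funext A
    refine LinearMap.ext fun f => ?_
    simp

/-- The space `B^d_P(1)` of natural unary operations of degree `d`: the families `U` which for each
`m` map `C^m_P(A; A)` to `C^{m+d}_P(A; A)` through a natural operation. -/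
noncomputable def B (d : ℤ) : Submodule k D.Ambient :=
  ⨅ (m : ℕ) (m' : ℕ),
    (if (m' : ℤ) = m + d then D.natural m m' else ⊥).comap (D.component m m')

/-- The differential `d_P` of the cochain complex. -/
noncomputable def dP : D.Ambient := fun A =>
  DirectSum.toModule k ℕ (D.Total A) fun m => incl A (m + 1) ∘ₗ diff A m

/-- The differential `δ_P(U) = d_P U - (-1)^d U d_P` on operations of degree `d`. -/
noncomputable def δ (d : ℤ) : D.Ambient →ₗ[k] D.Ambient :=
  LinearMap.mulLeft k D.dP - (((Int.negOnePow d : ℤˣ) : ℤ) : k) • LinearMap.mulRight k D.dP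

variable {D}

theorem mem_B {d : ℤ} {U : D.Ambient} :
    U ∈ D.B d ↔ ∀ m m' : ℕ, ((m' : ℤ) = m + d → D.component m m' U ∈ D.natural m m') ∧
      ((m' : ℤ) ≠ m + d → D.component m m' U = 0) := by
  simp only [B, Submodule.mem_iInf, Submodule.mem_comap]
  refine forall_congr' fun m => forall_congr' fun m' => ?_
  by_cases h : (m' : ℤ) = m + d <;> simp [h]

theorem one_mem_B [CharZero k] : (1 : D.Ambient) ∈ D.B 0 := by
  refine mem_B.2 fun m m' => ⟨fun h => ?_, fun h => ?_⟩
  · obtain rfl : m' = m := by omega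
    convert natural_id (D := D) m' using 1
    funext A
    exact LinearMap.ext fun f => projection_incl A m' f
  · funext A
    exact LinearMap.ext fun f => projection_incl_ne A (by rintro rfl; simp at h) f

theorem mul_mem_B {d : ℤ} {V U : D.Ambient} (hV : V ∈ D.B d) (hU : U ∈ D.B 0) :
    V * U ∈ D.B d := by
  have hincl : ∀ (m : ℕ) (A : D.operad.Alg) (f : Cochain A m),
      U A (incl A m f) = incl A m (D.component m m U A f) := by
    intro m A f
    refine total_ext A fun m' => ?_
    by_cases h : m = m'
    · subst h
      exact (projection_incl A m _).symm
    · have h0 := congrFun ((mem_B.1 hU m m').2 (by simpa using fun h' : m' = m => h h'.symm)) A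
      exact (LinearMap.congr_fun h0 f).trans (projection_incl_ne A h _).symm
  have hcomp : ∀ m m' : ℕ, D.component m m' (V * U) =
      fun A => D.component m m' V A ∘ₗ D.component m m U A := by
    intro m m'
    funext A
    refine LinearMap.ext fun f => ?_
    change projection A m' (V A (U A (incl A m f))) = _
    rw [hincl]
    rfl
  refine mem_B.2 fun m m' => ⟨fun h => ?_, fun h => ?_⟩
  · rw [hcomp]
    exact natural_comp ((mem_B.1 hV m m').1 h) ((mem_B.1 hU m m).1 (by simp))
  · rw [hcomp, (mem_B.1 hV m m').2 h]
    funext A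
    exact LinearMap.zero_comp _

variable (D)

/-- The algebra of degree zero cocycles of `B_P(1)`. -/
noncomputable def Z0 [CharZero k] : Subalgebra k D.Ambient where
  carrier := {U | U ∈ D.B 0 ∧ D.δ 0 U = 0}
  mul_mem' := by
    rintro U V ⟨hU, hU'⟩ ⟨hV, hV'⟩
    refine ⟨mul_mem_B hU hV, ?_⟩
    have h1 : D.dP * U = U * D.dP := by simpa [δ, sub_eq_zero] using hU'
    have h2 : D.dP * V = V * D.dP := by simpa [δ, sub_eq_zero] using hV'
    simp only [δ, Int.negOnePow_zero, Units.val_one, Int.cast_one, one_smul, LinearMap.sub_apply,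
      LinearMap.mulLeft_apply, LinearMap.mulRight_apply, sub_eq_zero]
    rw [← mul_assoc, h1, mul_assoc, h2, mul_assoc]
  add_mem' := by
    rintro U V ⟨hU, hU'⟩ ⟨hV, hV'⟩
    exact ⟨(D.B 0).add_mem hU hV, by rw [map_add, hU', hV', add_zero]⟩
  algebraMap_mem' t := by
    rw [Algebra.algebraMap_eq_smul_one]
    exact ⟨(D.B 0).smul_mem t one_mem_B, by simp [δ]⟩

/-- The ideal of degree zero coboundaries `δ_P(B^{-1}_P(1))`. -/
noncomputable def coboundaries [CharZero k] : TwoSidedIdeal D.Z0 :=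
  TwoSidedIdeal.span {z | ∃ V ∈ D.B (-1), (z : D.Ambient) = D.δ (-1) V}

/-- The algebra `H^0(B_P(1), δ_P)`. -/
abbrev H0 [CharZero k] : Type (u + 1) := D.coboundaries.ringCon.Quotient

end QuadraticData

/-! ### Endomorphisms of an operad as a module over itself -/

section SelfModule

variable {k : Type u} [Field k] (Q : Operad k)

/-- The algebra `End_Q(Q)` of endomorphisms of an operad `Q` considered as a module over itself:
the collections of equivariant linear maps `α_n : Q(n) → Q(n)` which commute with the actions
`(q, x) ↦ q ∘ᵢ x` and `(x, q) ↦ x ∘ᵢ q` of `Q`. -/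
def Operad.selfEnd : Subalgebra k (∀ n : ℕ, Module.End k (Q.obj n)) where
  carrier := {α |
    (∀ {m n : ℕ} (σ : Fin m ≃ Fin n) (x : Q.obj m),
      α n (Q.relabel σ x) = Q.relabel σ (α m x)) ∧
    (∀ {m n N : ℕ} (i : Fin m) (e : Graft i n N) (q : Q.obj m) (x : Q.obj n),
      α N (Q.comp i e q x) = Q.comp i e q (α n x)) ∧
    (∀ {m n N : ℕ} (i : Fin m) (e : Graft i n N) (x : Q.obj m) (q : Q.obj n),
      α N (Q.comp i e x q) = Q.comp i e (α m x) q)}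
  mul_mem' := by
    rintro α β ⟨h₁, h₂, h₃⟩ ⟨h₁', h₂', h₃'⟩
    refine ⟨fun σ x => ?_, fun i e q x => ?_, fun i e x q => ?_⟩
    · simp only [Pi.mul_apply, Module.End.mul_apply, h₁', h₁]
    · simp only [Pi.mul_apply, Module.End.mul_apply, h₂', h₂]
    · simp only [Pi.mul_apply, Module.End.mul_apply, h₃', h₃]
  add_mem' := by
    rintro α β ⟨h₁, h₂, h₃⟩ ⟨h₁', h₂', h₃'⟩
    refine ⟨fun σ x => ?_, fun i e q x => ?_, fun i e x q => ?_⟩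
    · simp only [Pi.add_apply, LinearMap.add_apply, h₁', h₁, map_add]
    · simp only [Pi.add_apply, LinearMap.add_apply, h₂', h₂, map_add]
    · simp only [Pi.add_apply, LinearMap.add_apply, h₃', h₃, map_add]
  algebraMap_mem' t := by
    refine ⟨fun σ x => ?_, fun i e q x => ?_, fun i e x q => ?_⟩ <;>
      simp [Module.algebraMap_end_apply]

end SelfModule

namespace QuadraticData

variable {k : Type u} [Field k] {D : QuadraticData k}

/-- The natural map `id ⊗ α_{m+1}` on `C^m_P(A; A)` induced by `α ∈ End_{P^!}(P^!)`. -/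
noncomputable def induced (α : D.dual.selfEnd) (A : D.operad.Alg) (m : ℕ) :
    Cochain A m →ₗ[k] Cochain A m :=
  (TensorProduct.map LinearMap.id (α.1 (m + 1))).restrict (p := Cochain A m) (q := Cochain A m)
    (by
      intro f hf
      rw [mem_cochain] at hf ⊢
      intro σ
      have h : preRelabel A σ ∘ₗ TensorProduct.map LinearMap.id (α.1 (m + 1)) =
          TensorProduct.map LinearMap.id (α.1 (m + 1)) ∘ₗ preRelabel (D := D) A σ := by
        refine TensorProduct.ext' fun φ q => ?_
        simp [preRelabel, α.2.1]
      have h' := LinearMap.congr_fun h f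
      simp only [LinearMap.comp_apply] at h'
      have hσ := hf σ
      simp only [twist, LinearMap.smul_apply] at hσ ⊢
      rw [h', ← map_smul, hσ])

end QuadraticData

end OperadicNatOp

/-!
All three algebras are copies of `k`, embedded as the multiples of the identity, and this is how the
isomorphisms are obtained.

No operation lowers the degree, because the black vertices of a tree have at least two inputs and
no vertex is nullary (`NatTree.Valid.le`). Hence `B^{-1} = 0`, there are no coboundaries in degree
zero, and `H^0` is the algebra of degree zero cocycles. By the same count, the only trees which
preserve the degree are corollas with permuted legs (`NatTree.Valid.exists_eq_rename`), so that on
`C^m` a degree zero operation is `id ⊗ Φ` for an endomorphism `Φ` of `P^!(m+1)` which does not depend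
on the algebra (`exists_eq_map_of_mem_natural`).

Let now `z` be a cocycle. As `P^!(1)` is spanned by the unit, `z` acts on `C^0` by a scalar `c`.
Suppose that it acts on `C^m` by `c`, and on `C^{m+1}` by `id ⊗ Φ`. As `z` commutes with the
differential, `id ⊗ (Φ - c)` annihilates all coboundaries `d f`, for all algebras. One algebra is
enough to conclude that `Φ = c`: the test algebra has vectors `v₀, v₁, …`, the products
`e(v₀, v₁) = e` with values in a copy of `E`, and all iterated products zero, so that it is an
algebra over any quadratic operad with generators `E` (`exists_hom_of_comp_eq_zero`). For
`q ∈ P^!(m+1)` and a generator `l ∈ E^∨` of `P^!`, it has a cochain `f` such that `q ∘₁ l` is the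
coefficient of `d f` at `(v₀, …, v_{m+1})` (`exists_testRead_diff`).
The relabellings of the `q ∘₁ l` span `P^!(m+2)` (`modRel_hom_ext`), hence `Φ = c` by induction.

Likewise, `α ∈ End_{P^!}(P^!)` satisfies `α(q) = α(1) ∘₁ q`, and `α(1)` is a multiple of `1`. The
unit of `P^!` is not zero, as the ground field with zero products is an algebra over every quadratic
operad (`modRel_one_ne_zero`), so that the scalars are determined by the operations.
-/

namespace OperadicNatOp

/-! ### Trees with one white vertex and operations of degree at most zero -/

namespace NatTree

variable {P : ℕ → Type u} {a b : ℕ}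

/-- The total number of legs. -/
def size (T : NatTree P a b) : ℕ := ∑ j, T.legs j

theorem size_leaf (j : Fin b) : (leaf j : NatTree P a b).size = 1 := by
  simp [size, legs]

theorem size_black {r : ℕ} (hr : 2 ≤ r) (p : P r) (c : Fin r → NatTree P a b) :
    (black hr p c).size = ∑ i, (c i).size := by
  simp only [size, legs]
  exact Finset.sum_comm

theorem size_white (c : Fin a → NatTree P a b) : (white c).size = ∑ i, (c i).size := by
  simp only [size, legs]
  exact Finset.sum_comm

theorem Valid.size_eq {T : NatTree P a b} (hT : T.Valid) : T.size = b := by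
  simp [size, hT.2]

theorem one_le_size (ha : 1 ≤ a) (T : NatTree P a b) : 1 ≤ T.size := by
  induction T with
  | leaf j => rw [size_leaf]
  | black hr p c ih =>
    rw [size_black]
    have := Finset.card_nsmul_le_sum Finset.univ (fun i => (c i).size) 1 fun i _ => ih i
    simp at this
    omega
  | white c ih =>
    rw [size_white]
    have := Finset.card_nsmul_le_sum Finset.univ (fun i => (c i).size) 1 fun i _ => ih i
    simp at this
    omega

theorem two_le_size_black (ha : 1 ≤ a) {r : ℕ} (hr : 2 ≤ r) (p : P r)
    (c : Fin r → NatTree P a b) : 2 ≤ (black hr p c).size := by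
  rw [size_black]
  have := Finset.card_nsmul_le_sum Finset.univ (fun i => (c i).size) 1
    fun i _ => one_le_size ha (c i)
  simp at this
  omega

theorem le_size_white (ha : 1 ≤ a) (c : Fin a → NatTree P a b) : a ≤ (white c).size := by
  rw [size_white]
  have := Finset.card_nsmul_le_sum Finset.univ (fun i => (c i).size) 1
    fun i _ => one_le_size ha (c i)
  simpa using this

theorem lt_size_black (ha : 1 ≤ a) {r : ℕ} (hr : 2 ≤ r) (p : P r)
    (c : Fin r → NatTree P a b) (i : Fin r) (hi : a ≤ (c i).size) :
    a < (black hr p c).size := by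
  rw [size_black]
  obtain ⟨j, hj⟩ : ∃ j : Fin r, j ≠ i := by
    have : Nontrivial (Fin r) := Fin.nontrivial_iff_two_le.2 hr
    exact exists_ne i
  have h := Finset.add_le_sum (f := fun i => (c i).size) (fun _ _ => Nat.zero_le _)
    (Finset.mem_univ i) (Finset.mem_univ j) hj.symm
  have := one_le_size ha (c j)
  omega

theorem le_size (ha : 1 ≤ a) (T : NatTree P a b) (hT : T.whites ≠ 0) : a ≤ T.size := by
  induction T with
  | leaf j => simp [whites] at hT
  | black hr p c ih =>
    obtain ⟨i, -, hi⟩ := Finset.exists_ne_zero_of_sum_ne_zero hT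
    exact (lt_size_black ha hr p c i (ih i hi)).le
  | white c ih => exact le_size_white ha c

/-- The unary natural operations cannot lower the degree: black vertices have at least two inputs
and no vertex is nullary, so a tree has at least as many legs as its white vertex has inputs. -/
theorem Valid.le (ha : 1 ≤ a) {T : NatTree P a b} (hT : T.Valid) : a ≤ b := by
  rw [← hT.size_eq]
  exact le_size ha T (by rw [hT.1]; exact one_ne_zero)

/-- A valid tree with as many legs as inputs of the white vertex has no black vertices. -/
theorem Valid.exists_eq_rename (ha : 1 ≤ a) {T : NatTree P a a} (hT : T.Valid) :
    ∃ σ : Equiv.Perm (Fin a), T = corolla.rename σ := by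
  have hs := hT.size_eq
  cases T with
  | leaf j => exact absurd hT.1 (by simp [whites])
  | black hr p c =>
    have hw : ∑ i, (c i).whites ≠ 0 := by
      have := hT.1
      simp only [whites] at this
      omega
    obtain ⟨i, -, hi⟩ := Finset.exists_ne_zero_of_sum_ne_zero hw
    have := lt_size_black ha hr p c i (le_size ha (c i) hi)
    omega
  | white c =>
    have hw : ∀ i, (c i).whites = 0 := by
      have := hT.1
      simp only [whites] at this
      have h0 : ∑ i, (c i).whites = 0 := by omega
      exact fun i => Finset.sum_eq_zero_iff.1 h0 i (Finset.mem_univ i)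
    have h1 : ∀ i, (c i).size = 1 := by
      rw [size_white] at hs
      have h : ∑ i : Fin a, 1 = ∑ i, (c i).size := by simp [hs]
      exact fun i => ((Finset.sum_eq_sum_iff_of_le fun i _ => one_le_size ha (c i)).1 h i
        (Finset.mem_univ i)).symm
    have hl : ∀ i, ∃ j, c i = leaf j := by
      intro i
      have hwi := hw i
      have hsi := h1 i
      generalize c i = t at hwi hsi
      cases t with
      | leaf j => exact ⟨j, rfl⟩
      | black hr p d =>
        have := two_le_size_black ha hr p d
        omega
      | white d => simp [whites] at hwi
    choose σ hσ using hl
    obtain rfl : c = fun i => leaf (σ i) := funext hσ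
    have hsurj : Function.Surjective σ := by
      intro j
      have := hT.2 j
      simp only [legs] at this
      obtain ⟨i, -, hi⟩ := Finset.exists_ne_zero_of_sum_ne_zero (this.trans_ne one_ne_zero)
      exact ⟨i, by by_contra h; simp [h] at hi⟩
    exact ⟨Equiv.ofBijective σ (Finite.surjective_iff_bijective.1 hsurj), rfl⟩

end NatTree

namespace QuadraticData

variable {k : Type u} [Field k] {D : QuadraticData k}

theorem natural_eq_bot {m m' : ℕ} (h : m' < m) : D.natural m m' = ⊥ := by
  refine Submodule.span_eq_bot.2 ?_
  rintro _ ⟨T, hT, -⟩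
  have := hT.le (Nat.succ_pos m)
  omega

theorem family_ext {U : D.Ambient} (h : ∀ m m', D.component m m' U = 0) : U = 0 := by
  funext A
  refine DirectSum.linearMap_ext k fun m => LinearMap.ext fun f => total_ext A fun m' => ?_
  have := LinearMap.congr_fun (congrFun (h m m') A) f
  exact this.trans (map_zero (projection A m')).symm

/-- There are no natural operations of negative degree. -/
theorem B_neg_one : D.B (-1) = ⊥ := by
  refine (Submodule.eq_bot_iff _).2 fun U hU => family_ext fun m m' => ?_
  by_cases h : (m' : ℤ) = m + -1
  · have := (mem_B.1 hU m m').1 h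
    rwa [natural_eq_bot (by omega), Submodule.mem_bot] at this
  · exact (mem_B.1 hU m m').2 h

theorem preRelabel_tmul (A : D.operad.Alg) {m n : ℕ} (σ : Fin m ≃ Fin n)
    (φ : (endOperad k A.carrier).obj m) (q : D.dual.obj m) :
    preRelabel A σ (φ ⊗ₜ[k] q) =
      ((endOperad k A.carrier).relabel σ φ) ⊗ₜ[k] (D.dual.relabel σ q) :=
  TensorProduct.map_tmul _ _ _ _

/-- On the invariants, relabelling the inputs of the multilinear factor only amounts, up to a sign,
to the inverse relabelling of the `P^!`-factor. -/
theorem map_relabel_id_eq {A : D.operad.Alg} {n : ℕ} {f : D.Pre A n} (σ : Equiv.Perm (Fin n))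
    (hf : twist A σ f = f) :
    TensorProduct.map ((endOperad k A.carrier).relabel σ) LinearMap.id f =
      ((Equiv.Perm.sign σ : ℤ) : k) •
        TensorProduct.map LinearMap.id (D.dual.relabel σ.symm) f := by
  have h : TensorProduct.map LinearMap.id (D.dual.relabel σ.symm) ∘ₗ preRelabel A σ =
      TensorProduct.map ((endOperad k A.carrier).relabel σ) LinearMap.id := by
    refine TensorProduct.ext' fun φ q => ?_
    simp only [LinearMap.comp_apply, preRelabel_tmul, TensorProduct.map_tmul,
      Operad.relabel_trans, LinearMap.id_apply, Equiv.self_trans_symm]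
    rw [Operad.relabel_refl]
  have hs : (((Equiv.Perm.sign σ : ℤ) : k)) * ((Equiv.Perm.sign σ : ℤ) : k) = 1 := by
    rw [← Int.cast_mul, Int.units_coe_mul_self, Int.cast_one]
  conv_rhs => rw [← hf]
  rw [← h, twist, LinearMap.smul_apply, map_smul, smul_smul, hs, one_smul, LinearMap.comp_apply]

/-- Degree zero natural operations act through the `P^!`-factor only. -/
theorem exists_eq_map_of_mem_natural {m : ℕ} {U : D.Family m m} (hU : U ∈ D.natural m m) :
    ∃ Φ : Module.End k (D.dual.obj (m + 1)), ∀ (A : D.operad.Alg) (f : Cochain A m),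
      (U A f : D.Pre A (m + 1)) = TensorProduct.map LinearMap.id Φ f := by
  induction hU using Submodule.span_induction with
  | zero =>
    refine ⟨0, fun A f => ?_⟩
    rw [TensorProduct.map_zero_right]
    rfl
  | add U V _ _ hU hV =>
    obtain ⟨Φ, hΦ⟩ := hU
    obtain ⟨Ψ, hΨ⟩ := hV
    refine ⟨Φ + Ψ, fun A f => ?_⟩
    rw [TensorProduct.map_add_right, LinearMap.add_apply, ← hΦ, ← hΨ]
    rfl
  | smul t U _ hU =>
    obtain ⟨Φ, hΦ⟩ := hU
    refine ⟨t • Φ, fun A f => ?_⟩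
    rw [TensorProduct.map_smul_right, LinearMap.smul_apply, ← hΦ]
    rfl
  | mem U hU =>
    obtain ⟨T, hT, Φ, rfl⟩ := hU
    -- the tree permutes the inputs; averaging and the invariance of `f` move all permutations to `P^!`
    obtain ⟨σ, rfl⟩ := hT.exists_eq_rename (Nat.succ_pos m)
    refine ⟨((m + 1).factorial : k)⁻¹ • ∑ ρ : Equiv.Perm (Fin (m + 1)),
      ((Equiv.Perm.sign ρ : ℤ) : k) • ((Equiv.Perm.sign (σ.trans ρ) : ℤ) : k) •
        (D.dual.relabel ρ ∘ₗ Φ ∘ₗ D.dual.relabel (σ.trans ρ).symm), fun A f => ?_⟩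
    have hop : ∀ φ, (NatTree.corolla.rename σ).op A hT φ =
        (endOperad k A.carrier).relabel σ φ := by
      intro φ
      rw [NatTree.op_rename A _ NatTree.valid_corolla, NatTree.op_corolla]
    have key : ∀ ρ : Equiv.Perm (Fin (m + 1)),
        preRelabel A ρ ∘ₗ TensorProduct.map ((NatTree.corolla.rename σ).op A hT) Φ =
          TensorProduct.map LinearMap.id (D.dual.relabel ρ ∘ₗ Φ) ∘ₗ
            TensorProduct.map ((endOperad k A.carrier).relabel (σ.trans ρ)) LinearMap.id := by
      intro ρ
      refine TensorProduct.ext' fun φ q => ?_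
      simp only [LinearMap.comp_apply, preRelabel_tmul, TensorProduct.map_tmul, hop,
        Operad.relabel_trans, LinearMap.id_apply]
    change averEnd A (m + 1) (TensorProduct.map _ Φ (f : D.Pre A (m + 1))) = _
    simp only [averEnd, twist, LinearMap.smul_apply, LinearMap.sum_apply,
      TensorProduct.map_smul_right]
    have hsum : ∀ g : Equiv.Perm (Fin (m + 1)) → Module.End k (D.dual.obj (m + 1)),
        TensorProduct.map LinearMap.id (∑ ρ, g ρ) (f : D.Pre A (m + 1)) =
          ∑ ρ, TensorProduct.map LinearMap.id (g ρ) (f : D.Pre A (m + 1)) := fun g => by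
      have := map_sum ((TensorProduct.mapBilinear (RingHom.id k) _ _ _ _
        (LinearMap.id : Module.End k ((endOperad k A.carrier).obj (m + 1)))) :
          _ →ₗ[k] D.Pre A (m + 1) →ₗ[k] D.Pre A (m + 1)) g Finset.univ
      exact (LinearMap.congr_fun this _).trans (LinearMap.sum_apply _ _ _)
    rw [hsum]
    refine congrArg _ (Finset.sum_congr rfl fun ρ _ => ?_)
    rw [TensorProduct.map_smul_right, TensorProduct.map_smul_right]
    refine congrArg _ ?_
    have := LinearMap.congr_fun (key ρ) f
    simp only [LinearMap.comp_apply] at this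
    rw [this, map_relabel_id_eq _ (mem_cochain.1 f.2 _), map_smul, LinearMap.smul_apply]
    refine congrArg _ ?_
    rw [← LinearMap.comp_apply, ← TensorProduct.map_comp]
    rfl

end QuadraticData

/-! ### Morphisms out of quadratic operads -/

section FreeLift

variable {k : Type u} [Field k] {E : Type u} [AddCommGroup E] [Module k E] {τ : E →ₗ[k] E}

/-- The value in an operad `O` of an expression, with the generators interpreted through `μ`. -/
def FreeTerm.value (O : Operad k) (μ : E →ₗ[k] O.obj 2) : ∀ {n : ℕ}, FreeTerm k E n → O.obj n
  | _, .zero => 0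
  | _, .add s t => s.value O μ + t.value O μ
  | _, .smul c t => c • t.value O μ
  | _, .gen e => μ e
  | _, .one => O.one
  | _, .relabel σ t => O.relabel σ (t.value O μ)
  | _, .comp i e s t => O.comp i e (s.value O μ) (t.value O μ)

theorem FreeTerm.Rel.value_eq {O : Operad k} {μ : E →ₗ[k] O.obj 2}
    (hμ : ∀ e, μ (τ e) = O.relabel (Equiv.swap 0 1) (μ e)) {n : ℕ} {s t : FreeTerm k E n}
    (h : FreeTerm.Rel τ s t) : s.value O μ = t.value O μ := by
  induction h with
  | add_left t _ ih => simp only [FreeTerm.value, ih]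
  | add_right s _ ih => simp only [FreeTerm.value, ih]
  | smul_congr c _ ih => simp only [FreeTerm.value, ih]
  | relabel_congr σ _ ih => simp only [FreeTerm.value, ih]
  | comp_left i e t _ ih => simp only [FreeTerm.value, ih]
  | comp_right i e s _ ih => simp only [FreeTerm.value, ih]
  | add_assoc => exact _root_.add_assoc _ _ _
  | add_comm => exact _root_.add_comm _ _
  | zero_add => exact _root_.zero_add _
  | smul_add => exact _root_.smul_add _ _ _
  | add_smul => exact _root_.add_smul _ _ _
  | mul_smul => exact SemigroupAction.mul_smul _ _ _
  | one_smul => exact _root_.one_smul _ _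
  | zero_smul => exact _root_.zero_smul _ _
  | relabel_add => exact map_add _ _ _
  | relabel_smul => exact map_smul _ _ _
  | comp_add_left => simp [FreeTerm.value]
  | comp_smul_left => simp [FreeTerm.value]
  | comp_add_right => simp [FreeTerm.value]
  | comp_smul_right => simp [FreeTerm.value]
  | gen_add => exact map_add _ _ _
  | gen_smul => exact map_smul _ _ _
  | gen_swap e => exact hμ e
  | relabel_refl => exact O.relabel_refl _
  | relabel_trans => exact O.relabel_trans _ _ _
  | relabel_comp => exact O.relabel_comp _ _ _ _ _
  | comp_relabel i σ ρ e e' h h' => exact O.comp_relabel i σ ρ e e' h h' _ _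
  | comp_one i e σ h h' => exact O.comp_one i e σ h h' _
  | one_comp i e σ h => exact O.one_comp i e σ h _
  | comp_comp i j e e' f f' h₁ h₂ h₃ => exact O.comp_comp i j e e' f f' h₁ h₂ h₃ _ _ _
  | comp_comm i j hij e e' f f' h₁ h₂ h₃ => exact O.comp_comm i j hij e e' f f' h₁ h₂ h₃ _ _ _

/-- The morphism out of the free operad given by its universal property. -/
def freeLift (O : Operad k) (μ : E →ₗ[k] O.obj 2)
    (hμ : ∀ e, μ (τ e) = O.relabel (Equiv.swap 0 1) (μ e)) : (freeOperad τ).Hom O where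
  toFun _ :=
    { toFun := Quot.lift (FreeTerm.value O μ) fun _ _ h => h.value_eq hμ
      map_add' := fun x y => Quot.induction_on₂ x y fun _ _ => rfl
      map_smul' := fun _ x => Quot.inductionOn x fun _ => rfl }
  map_relabel _ p := Quot.inductionOn p fun _ => rfl
  map_comp _ _ p q := Quot.induction_on₂ p q fun _ _ => rfl
  map_one := rfl

/-- Induction over the elements of a quotient of a free operad by an operadic ideal. -/
theorem modRel_induction {R : Submodule k ((freeOperad τ).obj 3)}
    (M : ∀ n, Submodule k (((freeOperad τ).modRel R).obj n))
    (hgen : ∀ e, ((freeOperad τ).toModRel R).toFun 2 (freeGen τ e) ∈ M 2)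
    (hone : ((freeOperad τ).modRel R).one ∈ M 1)
    (hrel : ∀ {m n : ℕ} (σ : Fin m ≃ Fin n) (p), p ∈ M m →
      ((freeOperad τ).modRel R).relabel σ p ∈ M n)
    (hcomp : ∀ {m n N : ℕ} (i : Fin m) (e : Graft i n N) (p q), p ∈ M m → q ∈ M n →
      ((freeOperad τ).modRel R).comp i e p q ∈ M N)
    {l : ℕ} (p : ((freeOperad τ).modRel R).obj l) : p ∈ M l := by
  obtain ⟨x, rfl⟩ := Submodule.Quotient.mk_surjective _ p
  induction x using Quot.inductionOn with
  | h t =>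
    change ((freeOperad τ).toModRel R).toFun l (FreeObj.mk τ t) ∈ M l
    induction t with
    | zero => exact (M _).zero_mem
    | add s t hs ht => exact (M _).add_mem hs ht
    | smul c t ht => exact (M _).smul_mem c ht
    | gen e => exact hgen e
    | one => exact hone
    | relabel σ t ht => exact hrel σ _ ht
    | comp i e s t hs ht => exact hcomp i e _ _ hs ht

theorem Graft.add_eq {m n N : ℕ} {i : Fin m} (e : Graft i n N) : N + 1 = m + n := by
  have h := Fintype.card_congr e
  have hm := i.pos
  simp only [ne_eq, Fintype.card_sum, Fintype.card_fin, Fintype.card_subtype_compl,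
    Fintype.card_subtype_eq] at h
  omega

theorem eq_of_equiv_fin {m n : ℕ} (σ : Fin m ≃ Fin n) : m = n := by
  simpa using Fintype.card_congr σ

theorem Operad.exists_comp_one (O : Operad k) {m N : ℕ} (i : Fin m) (e : Graft i 1 N) :
    ∃ σ : Fin m ≃ Fin N, ∀ p, O.comp i e p O.one = O.relabel σ p := by
  have : Unique {x : Fin m // ¬ x ≠ i} :=
    ⟨⟨⟨i, fun h => h rfl⟩⟩, fun x => Subtype.ext (not_not.1 x.2)⟩
  let σ : Fin m ≃ Fin N := (Equiv.sumCompl (· ≠ i)).symm.trans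
    ((Equiv.sumCongr (Equiv.refl _) (Equiv.ofUnique _ (Fin 1))).trans e)
  refine ⟨σ, O.comp_one i e σ (fun x => ?_) ?_⟩
  · simp only [σ, Equiv.trans_apply]
    rw [Equiv.sumCompl_symm_apply_of_pos (p := (· ≠ i)) x.2]
    rfl
  · simp only [σ, Equiv.trans_apply]
    rw [Equiv.sumCompl_symm_apply_of_neg (p := (· ≠ i)) (a := i) fun h => h rfl]
    exact congrArg (fun y => e (Sum.inr y)) (Subsingleton.elim _ _)

theorem Operad.exists_one_comp (O : Operad k) {n N : ℕ} (i : Fin 1) (e : Graft i n N) :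
    ∃ σ : Fin n ≃ Fin N, ∀ q, O.comp i e O.one q = O.relabel σ q := by
  have : IsEmpty {x : Fin 1 // x ≠ i} := ⟨fun x => x.2 (Subsingleton.elim _ _)⟩
  exact ⟨(Equiv.emptySum _ _).symm.trans e, O.one_comp i e _ fun _ => rfl⟩

/-- The suboperad spanned by the unit and by a space of binary operations all of whose compositions
vanish. -/
def lowSpan (O : Operad k) (M : Submodule k (O.obj 2)) : ∀ n, Submodule k (O.obj n)
  | 1 => Submodule.span k {O.one}
  | 2 => M
  | _ => ⊥

theorem relabel_mem_lowSpan {O : Operad k} {M : Submodule k (O.obj 2)}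
    (hM : ∀ (σ : Equiv.Perm (Fin 2)), ∀ p ∈ M, O.relabel σ p ∈ M)
    {m n : ℕ} (σ : Fin m ≃ Fin n) {p : O.obj m} (hp : p ∈ lowSpan O M m) :
    O.relabel σ p ∈ lowSpan O M n := by
  obtain rfl := eq_of_equiv_fin σ
  match m, p, hp with
  | 0, _, hp => rw [(Submodule.mem_bot k).1 hp, map_zero]; exact Submodule.zero_mem _
  | 1, _, hp => rwa [show σ = Equiv.refl _ from Subsingleton.elim _ _, O.relabel_refl]
  | 2, p, hp => exact hM σ p hp
  | m + 3, _, hp => rw [(Submodule.mem_bot k).1 hp, map_zero]; exact Submodule.zero_mem _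

theorem comp_mem_lowSpan {O : Operad k} {M : Submodule k (O.obj 2)}
    (hM : ∀ (σ : Equiv.Perm (Fin 2)), ∀ p ∈ M, O.relabel σ p ∈ M)
    (h0 : ∀ {N : ℕ} (i : Fin 2) (e : Graft i 2 N), ∀ p ∈ M, ∀ q ∈ M, O.comp i e p q = 0)
    {m n N : ℕ} (i : Fin m) (e : Graft i n N) {p : O.obj m} {q : O.obj n}
    (hp : p ∈ lowSpan O M m) (hq : q ∈ lowSpan O M n) : O.comp i e p q ∈ lowSpan O M N := by
  match m, n, p, q, hp, hq with
  | 0, _, _, _, _, _ => exact i.elim0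
  | 1, _, _, _, hp, hq =>
    obtain ⟨c, rfl⟩ := Submodule.mem_span_singleton.1 hp
    obtain ⟨σ, hσ⟩ := O.exists_one_comp i e
    rw [map_smul, LinearMap.smul_apply, hσ]
    exact Submodule.smul_mem _ _ (relabel_mem_lowSpan hM σ hq)
  | 2, 0, _, _, _, hq =>
    rw [(Submodule.mem_bot k).1 hq, map_zero]
    exact Submodule.zero_mem _
  | 2, 1, _, _, hp, hq =>
    obtain ⟨c, rfl⟩ := Submodule.mem_span_singleton.1 hq
    obtain ⟨σ, hσ⟩ := O.exists_comp_one i e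
    rw [map_smul, hσ]
    exact Submodule.smul_mem _ _ (relabel_mem_lowSpan hM σ hp)
  | 2, 2, p, q, hp, hq =>
    rw [h0 i e p hp q hq]
    exact Submodule.zero_mem _
  | 2, _ + 3, _, _, _, hq =>
    rw [(Submodule.mem_bot k).1 hq, map_zero]
    exact Submodule.zero_mem _
  | _ + 3, _, _, _, hp, _ =>
    rw [(Submodule.mem_bot k).1 hp, map_zero, LinearMap.zero_apply]
    exact Submodule.zero_mem _

theorem Operad.toModRel_surjective (P : Operad k) (R : Submodule k (P.obj 3)) (n : ℕ) :
    Function.Surjective ((P.toModRel R).toFun n) :=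
  Submodule.Quotient.mk_surjective _

/-- The factorization through `P/(R)`, in a given arity, of a morphism that kills the ideal `(R)`. -/
def Operad.Hom.factor {P O : Operad k} (G : P.Hom O) (R : Submodule k (P.obj 3)) (n : ℕ)
    (h : P.idealSpan (R : Set (P.obj 3)) n ≤ LinearMap.ker (G.toFun n)) :
    (P.modRel R).obj n →ₗ[k] O.obj n :=
  (P.idealSpan (R : Set (P.obj 3)) n).liftQ (G.toFun n) h

theorem Operad.Hom.factor_apply {P O : Operad k} (G : P.Hom O) (R : Submodule k (P.obj 3)) (n : ℕ)
    (h : P.idealSpan (R : Set (P.obj 3)) n ≤ LinearMap.ker (G.toFun n)) (p : P.obj n) :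
    G.factor R n h ((P.toModRel R).toFun n p) = G.toFun n p :=
  rfl

/-- A morphism of operads that annihilates `R` factors through the quotient by `R`. -/
theorem Operad.Hom.exists_liftModRel {P O : Operad k} (G : P.Hom O) (R : Submodule k (P.obj 3))
    (hR : ∀ r ∈ R, G.toFun 3 r = 0) :
    ∃ F : (P.modRel R).Hom O, ∀ n p, F.toFun n ((P.toModRel R).toFun n p) = G.toFun n p := by
  have hker : ∀ n, P.idealSpan (R : Set (P.obj 3)) n ≤ LinearMap.ker (G.toFun n) := by
    intro n x hx
    refine P.mem_idealSpan.1 hx (fun n => LinearMap.ker (G.toFun n)) ?_ hR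
    constructor
    · intro m n σ p hp
      rw [LinearMap.mem_ker] at hp ⊢
      rw [G.map_relabel, hp, map_zero]
    · intro m n N i e p q hp
      rw [LinearMap.mem_ker] at hp ⊢
      rw [G.map_comp, hp, map_zero, LinearMap.zero_apply]
    · intro m n N i e p q hq
      rw [LinearMap.mem_ker] at hq ⊢
      rw [G.map_comp, hq, map_zero]
  obtain ⟨T, hT⟩ : ∃ T : ∀ n, (P.modRel R).obj n →ₗ[k] O.obj n,
      ∀ n p, T n ((P.toModRel R).toFun n p) = G.toFun n p :=
    ⟨fun n => G.factor R n (hker n), fun n p => G.factor_apply R n (hker n) p⟩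
  refine ⟨⟨T, fun σ p => ?_, fun i e p q => ?_, ?_⟩, hT⟩
  · obtain ⟨p, rfl⟩ := P.toModRel_surjective R _ p
    rw [← (P.toModRel R).map_relabel, hT, hT, G.map_relabel]
  · obtain ⟨p, rfl⟩ := P.toModRel_surjective R _ p
    obtain ⟨q, rfl⟩ := P.toModRel_surjective R _ q
    rw [← (P.toModRel R).map_comp, hT, hT, hT, G.map_comp]
  · rw [← (P.toModRel R).map_one, hT, G.map_one]

theorem Equiv.Perm.eq_one_or_eq_swap (σ : Equiv.Perm (Fin 2)) : σ = 1 ∨ σ = Equiv.swap 0 1 := by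
  revert σ
  decide

/-- If the binary operations `μ e` of an operad `O` satisfy all relations `μ e ∘ᵢ μ e' = 0`, then
they define a morphism to `O` from every quadratic operad generated by `E`. -/
theorem exists_hom_of_comp_eq_zero (R : Submodule k ((freeOperad τ).obj 3)) (O : Operad k)
    (μ : E →ₗ[k] O.obj 2) (hμ : ∀ e, μ (τ e) = O.relabel (Equiv.swap 0 1) (μ e))
    (h0 : ∀ {N : ℕ} (i : Fin 2) (e : Graft i 2 N) (x y : E), O.comp i e (μ x) (μ y) = 0) :
    ∃ F : ((freeOperad τ).modRel R).Hom O,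
      ∀ e, F.toFun 2 (((freeOperad τ).toModRel R).toFun 2 (freeGen τ e)) = μ e := by
  have hM : ∀ (σ : Equiv.Perm (Fin 2)), ∀ p ∈ LinearMap.range μ, O.relabel σ p ∈
      LinearMap.range μ := by
    rintro σ _ ⟨e, rfl⟩
    obtain rfl | rfl := Equiv.Perm.eq_one_or_eq_swap σ
    · exact ⟨e, (O.relabel_refl _).symm⟩
    · exact ⟨τ e, hμ e⟩
  have h0' : ∀ {N : ℕ} (i : Fin 2) (e : Graft i 2 N), ∀ p ∈ LinearMap.range μ,
      ∀ q ∈ LinearMap.range μ, O.comp i e p q = 0 := by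
    rintro N i e _ ⟨x, rfl⟩ _ ⟨y, rfl⟩
    exact h0 i e x y
  let G := freeLift O μ hμ
  have hlow : ∀ {n : ℕ} (t : FreeTerm k E n),
      G.toFun n (FreeObj.mk τ t) ∈ lowSpan O (LinearMap.range μ) n := by
    intro n t
    induction t with
    | zero => exact Submodule.zero_mem _
    | add s t hs ht => exact Submodule.add_mem _ hs ht
    | smul c t ht => exact Submodule.smul_mem _ c ht
    | gen e => exact ⟨e, rfl⟩
    | one => exact Submodule.mem_span_singleton_self _
    | relabel σ t ht => exact relabel_mem_lowSpan hM σ ht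
    | comp i e s t hs ht => exact comp_mem_lowSpan hM h0' i e hs ht
  obtain ⟨F, hF⟩ := G.exists_liftModRel R fun r _ => by
    induction r using Quot.inductionOn with
    | h t => exact (Submodule.mem_bot k).1 (hlow t)
  exact ⟨F, fun e => hF 2 _⟩

/-- The trivial algebra on `k` shows that the unit of a quadratic operad does not vanish. -/
theorem modRel_one_ne_zero (R : Submodule k ((freeOperad τ).obj 3)) :
    ((freeOperad τ).modRel R).one ≠ 0 := by
  obtain ⟨F, -⟩ := exists_hom_of_comp_eq_zero R (endOperad k k) 0 (fun e => by simp)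
    (fun i e x y => by simp)
  intro h
  have h1 : (endOperad k k).one = 0 := by rw [← F.map_one, h, map_zero]
  have h2 : NatTree.asMap (endOperad k k).one (fun _ => (1 : k)) = (1 : k) := rfl
  rw [h1] at h2
  exact zero_ne_one h2

end FreeLift

/-! ### Generation of quadratic operads -/

section Generation

variable {k : Type u} [Field k]

/-- Reassociation `p ∘ᵢ (q ∘ⱼ r) = (p ∘ᵢ q) ∘ r`. -/
theorem Operad.exists_comp_assoc (O : Operad k) {m n l M L : ℕ} (i : Fin m) (j : Fin n)
    (f : Graft j l M) (f' : Graft i M L) :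
    ∃ (N : ℕ) (e : Graft i n N) (c : Fin N) (e' : Graft c l L), ∀ p q r,
      O.comp i f' p (O.comp j f q r) = O.comp c e' (O.comp i e p q) r := by
  let N := Fintype.card ({x : Fin m // x ≠ i} ⊕ Fin n)
  let e : Graft i n N := Fintype.equivFin _
  let a : {y : Fin N // y ≠ e (Sum.inr j)} ≃ {x : Fin m // x ≠ i} ⊕ {y : Fin n // y ≠ j} :=
    (e.subtypeEquiv (p := fun s => s ≠ Sum.inr j) fun s => by simp).symm.trans
      ((Equiv.subtypeSum (p := fun s : {x : Fin m // x ≠ i} ⊕ Fin n => s ≠ Sum.inr j)).trans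
        (Equiv.sumCongr (Equiv.subtypeUnivEquiv fun x => Sum.inl_ne_inr)
          (Equiv.subtypeEquivRight fun y => by simp)))
  let e' : Graft (e (Sum.inr j)) l L :=
    (Equiv.sumCongr a (Equiv.refl _)).trans
      ((Equiv.sumAssoc _ _ _).trans ((Equiv.sumCongr (Equiv.refl _) f).trans f'))
  have ha : ∀ x : {x : Fin m // x ≠ i},
      a ⟨e (Sum.inl x), fun h => Sum.inl_ne_inr (e.injective h)⟩ = Sum.inl x := by
    intro x
    rw [← Equiv.eq_symm_apply]
    rfl
  have ha' : ∀ y : {y : Fin n // y ≠ j},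
      a ⟨e (Sum.inr y), fun h => y.2 (Sum.inr_injective (e.injective h))⟩ = Sum.inr y := by
    intro x
    rw [← Equiv.eq_symm_apply]
    rfl
  refine ⟨N, e, e (Sum.inr j), e', fun p q r => (O.comp_comp i j e e' f f' ?_ ?_ ?_ p q r).symm⟩
  · intro x
    change f' (Sum.map id f (Equiv.sumAssoc _ _ _ (Sum.map a id (Sum.inl _)))) = _
    rw [Sum.map_inl, ha]
    rfl
  · intro y
    change f' (Sum.map id f (Equiv.sumAssoc _ _ _ (Sum.map a id (Sum.inl _)))) = _
    rw [Sum.map_inl, ha']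
    rfl
  · intro z
    rfl

/-- Every labelled partial composition is a relabelled classical composition at the first input. -/
theorem Operad.exists_comp_eq_relabel_comp_std (O : Operad k) {m n N : ℕ} (hN : m + n = N)
    (i : Fin (m + 1)) (e : Graft i (n + 1) (N + 1)) (q : O.obj (m + 1)) :
    ∃ (ρ : Equiv.Perm (Fin (N + 1))) (q' : O.obj (m + 1)), ∀ r,
      O.comp i e q r = O.relabel ρ (O.comp 0 (Graft.std 0 hN) q' r) := by
  obtain ⟨σ, hσ⟩ : ∃ σ : Equiv.Perm (Fin (m + 1)), σ i = 0 :=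
    ⟨Equiv.swap i 0, Equiv.swap_apply_left i 0⟩
  let e' : Graft (0 : Fin (m + 1)) (n + 1) (N + 1) :=
    (Equiv.sumCongr (σ.subtypeEquiv fun x => by
      rw [← hσ, ne_eq, ne_eq, σ.injective.eq_iff]) (Equiv.refl _)).symm.trans e
  refine ⟨(Graft.std 0 hN).symm.trans e', O.relabel σ q, fun r => ?_⟩
  rw [O.relabel_comp, ← Equiv.trans_assoc, Equiv.self_trans_symm, Equiv.refl_trans]
  have key : ∀ (c : Fin (m + 1)) (hc : σ i = c) (e' : Graft c (n + 1) (N + 1)),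
      (∀ x : {x : Fin (m + 1) // x ≠ i},
        e' (Sum.inl ⟨σ x, fun h => x.2 (σ.injective (h.trans hc.symm))⟩) = e (Sum.inl x)) →
      (∀ y, e' (Sum.inr y) = e (Sum.inr y)) →
      O.comp i e q r = O.comp c e' (O.relabel σ q) r := by
    rintro _ rfl e' h h'
    conv_rhs => rw [← O.relabel_refl r]
    exact (O.comp_relabel i σ (Equiv.refl _) e e' h h' q r).symm
  refine key 0 hσ e' (fun x => ?_) fun y => rfl
  refine congrArg e ?_
  rw [Equiv.symm_apply_eq]
  rfl

variable {E : Type u} [AddCommGroup E] [Module k E] {τ : E →ₗ[k] E}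

/-- The operations obtained by grafting generators into inputs of other operations, together with the
multiples of the unit. -/
def graftSpan (O : Operad k) (μ : E →ₗ[k] O.obj 2) : ∀ n, Submodule k (O.obj n)
  | 0 => ⊥
  | 1 => Submodule.span k {O.one}
  | n + 2 => Submodule.span k {x | ∃ (i : Fin (n + 1)) (e : Graft i 2 (n + 2)) (q : O.obj (n + 1))
      (y : E), x = O.comp i e q (μ y)}

theorem relabel_mem_graftSpan {O : Operad k} {μ : E →ₗ[k] O.obj 2} {m n : ℕ}
    (σ : Fin m ≃ Fin n) {p : O.obj m} (hp : p ∈ graftSpan O μ m) :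
    O.relabel σ p ∈ graftSpan O μ n := by
  obtain rfl := eq_of_equiv_fin σ
  match m, p, hp with
  | 0, _, hp => rw [(Submodule.mem_bot k).1 hp, map_zero]; exact Submodule.zero_mem _
  | 1, _, hp => rwa [show σ = Equiv.refl _ from Subsingleton.elim _ _, O.relabel_refl]
  | m + 2, p, hp =>
    refine (Submodule.span_le.2 ?_ : _ ≤ (graftSpan O μ (m + 2)).comap (O.relabel σ)) hp
    rintro _ ⟨i, e, q, y, rfl⟩
    exact Submodule.subset_span ⟨i, e.trans σ, q, y, O.relabel_comp _ _ _ _ _⟩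

theorem comp_mem_graftSpan {O : Operad k} {μ : E →ₗ[k] O.obj 2} {m n N : ℕ} (i : Fin m)
    (e : Graft i n N) {p : O.obj m} {q : O.obj n} (hp : p ∈ graftSpan O μ m)
    (hq : q ∈ graftSpan O μ n) : O.comp i e p q ∈ graftSpan O μ N := by
  match n, q, hq with
  | 0, _, hq => rw [(Submodule.mem_bot k).1 hq, map_zero]; exact Submodule.zero_mem _
  | 1, _, hq =>
    obtain ⟨c, rfl⟩ := Submodule.mem_span_singleton.1 hq
    obtain ⟨σ, hσ⟩ := O.exists_comp_one i e
    rw [map_smul, hσ]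
    exact Submodule.smul_mem _ _ (relabel_mem_graftSpan σ hp)
  | n + 2, q, hq =>
    obtain ⟨N, rfl⟩ : ∃ N', N = N' + 2 := ⟨N - 2, by have := e.add_eq; have := i.pos; omega⟩
    refine (Submodule.span_le.2 ?_ : _ ≤ (graftSpan O μ (N + 2)).comap (O.comp i e p)) hq
    rintro _ ⟨j, f, r, y, rfl⟩
    obtain ⟨M, e₁, c, e₂, h⟩ := O.exists_comp_assoc i j f e
    obtain rfl : M = N + 1 := by have := e₂.add_eq; omega
    exact Submodule.subset_span ⟨c, e₂, O.comp i e₁ p r, y, h _ _ _⟩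

theorem mem_graftSpan {R : Submodule k ((freeOperad τ).obj 3)} {n : ℕ}
    (p : ((freeOperad τ).modRel R).obj n) :
    p ∈ graftSpan ((freeOperad τ).modRel R)
      (((freeOperad τ).toModRel R).toFun 2 ∘ₗ freeGen τ) n := by
  refine modRel_induction _ (fun y => ?_) (Submodule.mem_span_singleton_self _)
    (fun σ p hp => relabel_mem_graftSpan σ hp)
    (fun i e p q hp hq => comp_mem_graftSpan i e hp hq) p
  have : IsEmpty {x : Fin 1 // x ≠ 0} := ⟨fun x => x.2 (Subsingleton.elim _ _)⟩
  refine Submodule.subset_span ⟨0, Equiv.emptySum _ _, ((freeOperad τ).modRel R).one, y, ?_⟩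
  rw [Operad.one_comp _ 0 _ (Equiv.refl _) fun _ => rfl, Operad.relabel_refl]
  rfl

/-- In positive weight, `Γ(E)/(R)` is spanned by the relabelled compositions `q ∘₁ y`, where `y` is
a generator. -/
theorem modRel_hom_ext {R : Submodule k ((freeOperad τ).obj 3)} {m : ℕ} {V : Type*}
    [AddCommGroup V] [Module k V] {Ψ : ((freeOperad τ).modRel R).obj (m + 2) →ₗ[k] V}
    (h : ∀ (ρ : Equiv.Perm (Fin (m + 2))) (q : ((freeOperad τ).modRel R).obj (m + 1)) (y : E),
      Ψ (((freeOperad τ).modRel R).relabel ρ (((freeOperad τ).modRel R).comp 0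
        (Graft.std (m := m) (n := 1) 0 rfl) q
          (((freeOperad τ).toModRel R).toFun 2 (freeGen τ y)))) = 0) : Ψ = 0 := by
  refine LinearMap.ext fun p => ?_
  refine (Submodule.span_le.2 ?_ : _ ≤ LinearMap.ker Ψ) (mem_graftSpan p)
  rintro _ ⟨i, e, q, y, rfl⟩
  obtain ⟨ρ, q', hq⟩ :=
    ((freeOperad τ).modRel R).exists_comp_eq_relabel_comp_std (n := 1) rfl i e q
  exact (congrArg Ψ (hq _)).trans (h ρ q' y)

end Generation

/-! ### Invariance of the pre-Lie product under the symmetric group -/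

theorem Graft.std_inl {m n N : ℕ} (i : Fin (m + 1)) (hN : m + n = N)
    (x : {x : Fin (m + 1) // x ≠ i}) :
    ((Graft.std i hN (Sum.inl x)).1 : ℕ) = if x.1.1 < i.1 then x.1.1 else x.1.1 + n := by
  change (if x.1 < i then (⟨x.1.1, _⟩ : Fin (N + 1)) else ⟨x.1.1 + n, _⟩).1 = _
  simp only [Fin.lt_def]
  split_ifs <;> rfl

theorem Graft.std_inr {m n N : ℕ} (i : Fin (m + 1)) (hN : m + n = N) (y : Fin (n + 1)) :
    ((Graft.std i hN (Sum.inr y)).1 : ℕ) = i.1 + y.1 := rfl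

theorem Graft.std_inl_cases {m n N : ℕ} (i : Fin (m + 1)) (hN : m + n = N)
    (x : Fin (m + 1)) (hx : x ≠ i) :
    (x.1 < i.1 ∧ ((Graft.std i hN (Sum.inl ⟨x, hx⟩)).1 : ℕ) = x.1) ∨
      (i.1 < x.1 ∧ ((Graft.std i hN (Sum.inl ⟨x, hx⟩)).1 : ℕ) = x.1 + n) := by
  have hne : x.1 ≠ i.1 := fun h => hx (Fin.ext h)
  rw [Graft.std_inl]
  dsimp only
  split_ifs <;> omega

theorem val_swap_cases {n : ℕ} (a b x : Fin n) :
    (x.1 = a.1 ∧ (Equiv.swap a b x).1 = b.1) ∨ (x.1 = b.1 ∧ (Equiv.swap a b x).1 = a.1) ∨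
      (x.1 ≠ a.1 ∧ x.1 ≠ b.1 ∧ (Equiv.swap a b x).1 = x.1) := by
  rw [Equiv.swap_apply_def]
  simp only [Fin.ext_iff]
  split_ifs <;> omega

set_option maxHeartbeats 1000000 in
/-- The effect of an adjacent transposition `s` of the inputs of `f` on the inputs of `f ∘ᵢ g`, where
`g` is binary: up to a permutation `ρ`, `(s f) ∘_{s i} g` is `f ∘ᵢ g`. If `s` fixes `i` then `ρ` is a
transposition; otherwise `ρ` is a cyclic permutation of three inputs, and the missing sign comes from
the difference between `i` and `s i`. -/
theorem Graft.exists_perm_std_swap {m : ℕ} (j : Fin m) (i : Fin (m + 1))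
    (s : Equiv.Perm (Fin (m + 1))) (hs : s = Equiv.swap j.castSucc j.succ) :
    ∃ ρ : Equiv.Perm (Fin (m + 2)),
      (-1 : ℤ) ^ (s i).1 * (-1) * (Equiv.Perm.sign ρ : ℤ) = (-1) ^ i.1 ∧
      (∀ x : {x : Fin (m + 1) // x ≠ i},
        Graft.std (n := 1) (s i) rfl (Sum.inl ⟨s x, fun h => x.2 (s.injective h)⟩) =
          ρ (Graft.std (n := 1) i rfl (Sum.inl x))) ∧
      (∀ y : Fin 2, Graft.std (n := 1) (s i) rfl (Sum.inr y) =
        ρ (Graft.std (n := 1) i rfl (Sum.inr y))) := by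
  have hsx : ∀ x : {x : Fin (m + 1) // x ≠ i}, s x ≠ s i := fun x h => x.2 (s.injective h)
  obtain ⟨a, ha⟩ : ∃ a : Fin (m + 2), a.1 = j.1 := ⟨⟨j.1, by omega⟩, rfl⟩
  obtain ⟨b, hb⟩ : ∃ b : Fin (m + 2), b.1 = j.1 + 1 := ⟨⟨j.1 + 1, by omega⟩, rfl⟩
  obtain ⟨c, hc⟩ : ∃ c : Fin (m + 2), c.1 = j.1 + 2 := ⟨⟨j.1 + 2, by omega⟩, rfl⟩
  have hab : a ≠ b := fun h => by rw [h] at ha; omega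
  have hbc : b ≠ c := fun h => by rw [h] at hb; omega
  have hj := Fin.val_castSucc j
  have hj' := Fin.val_succ j
  have hi := val_swap_cases j.castSucc j.succ i
  rw [← hs] at hi
  have hcases : i.1 < j.1 ∨ i.1 = j.1 ∨ i.1 = j.1 + 1 ∨ j.1 + 1 < i.1 := by omega
  rcases hcases with hij | hij | hij | hij
  · replace hi : (s i).1 = i.1 := by omega
    refine ⟨Equiv.swap b c, ?_, fun x => ?_, fun y => ?_⟩
    · rw [Equiv.Perm.sign_swap hbc, hi]
      simp
    · obtain ⟨x, hxi⟩ := x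
      have h1 := Graft.std_inl_cases (n := 1) i rfl x hxi
      have h2 := Graft.std_inl_cases (n := 1) (s i) rfl (s x) (hsx ⟨x, hxi⟩)
      have h3 := val_swap_cases j.castSucc j.succ x
      have h4 : x.1 ≠ i.1 := fun h => hxi (Fin.ext h)
      rw [← hs] at h3
      generalize Graft.std (n := 1) i rfl (Sum.inl ⟨x, hxi⟩) = u at *
      generalize Graft.std (n := 1) (s i) rfl (Sum.inl ⟨s x, hsx ⟨x, hxi⟩⟩) = v at *
      generalize s x = z at *
      have h5 := val_swap_cases b c u
      generalize Equiv.swap b c u = w at *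
      refine Fin.ext ?_
      omega
    · have h1 := Graft.std_inr (n := 1) i rfl y
      have h2 := Graft.std_inr (n := 1) (s i) rfl y
      generalize Graft.std (n := 1) i rfl (Sum.inr y) = u at *
      generalize Graft.std (n := 1) (s i) rfl (Sum.inr y) = v at *
      have h5 := val_swap_cases b c u
      generalize Equiv.swap b c u = w at *
      refine Fin.ext ?_
      omega
  · replace hi : (s i).1 = i.1 + 1 := by omega
    refine ⟨Equiv.swap a b * Equiv.swap b c, ?_, fun x => ?_, fun y => ?_⟩
    · rw [Equiv.Perm.sign_mul, Equiv.Perm.sign_swap hab, Equiv.Perm.sign_swap hbc, hi]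
      simp [pow_succ]
    · obtain ⟨x, hxi⟩ := x
      have h1 := Graft.std_inl_cases (n := 1) i rfl x hxi
      have h2 := Graft.std_inl_cases (n := 1) (s i) rfl (s x) (hsx ⟨x, hxi⟩)
      have h3 := val_swap_cases j.castSucc j.succ x
      have h4 : x.1 ≠ i.1 := fun h => hxi (Fin.ext h)
      rw [← hs] at h3
      generalize Graft.std (n := 1) i rfl (Sum.inl ⟨x, hxi⟩) = u at *
      generalize Graft.std (n := 1) (s i) rfl (Sum.inl ⟨s x, hsx ⟨x, hxi⟩⟩) = v at *
      generalize s x = z at *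
      have h5 := val_swap_cases b c u
      have h6 := val_swap_cases a b (Equiv.swap b c u)
      rw [Equiv.Perm.mul_apply]
      generalize Equiv.swap b c u = t at *
      generalize Equiv.swap a b t = w at *
      refine Fin.ext ?_
      omega
    · have h1 := Graft.std_inr (n := 1) i rfl y
      have h2 := Graft.std_inr (n := 1) (s i) rfl y
      generalize Graft.std (n := 1) i rfl (Sum.inr y) = u at *
      generalize Graft.std (n := 1) (s i) rfl (Sum.inr y) = v at *
      have h5 := val_swap_cases b c u
      have h6 := val_swap_cases a b (Equiv.swap b c u)
      rw [Equiv.Perm.mul_apply]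
      generalize Equiv.swap b c u = t at *
      generalize Equiv.swap a b t = w at *
      refine Fin.ext ?_
      omega
  · replace hi : (s i).1 = j.1 := by omega
    refine ⟨Equiv.swap b c * Equiv.swap a b, ?_, fun x => ?_, fun y => ?_⟩
    · rw [Equiv.Perm.sign_mul, Equiv.Perm.sign_swap hab, Equiv.Perm.sign_swap hbc, hi, hij]
      simp [pow_succ]
    · obtain ⟨x, hxi⟩ := x
      have h1 := Graft.std_inl_cases (n := 1) i rfl x hxi
      have h2 := Graft.std_inl_cases (n := 1) (s i) rfl (s x) (hsx ⟨x, hxi⟩)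
      have h3 := val_swap_cases j.castSucc j.succ x
      have h4 : x.1 ≠ i.1 := fun h => hxi (Fin.ext h)
      rw [← hs] at h3
      generalize Graft.std (n := 1) i rfl (Sum.inl ⟨x, hxi⟩) = u at *
      generalize Graft.std (n := 1) (s i) rfl (Sum.inl ⟨s x, hsx ⟨x, hxi⟩⟩) = v at *
      generalize s x = z at *
      have h5 := val_swap_cases a b u
      have h6 := val_swap_cases b c (Equiv.swap a b u)
      rw [Equiv.Perm.mul_apply]
      generalize Equiv.swap a b u = t at *
      generalize Equiv.swap b c t = w at *
      refine Fin.ext ?_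
      omega
    · have h1 := Graft.std_inr (n := 1) i rfl y
      have h2 := Graft.std_inr (n := 1) (s i) rfl y
      generalize Graft.std (n := 1) i rfl (Sum.inr y) = u at *
      generalize Graft.std (n := 1) (s i) rfl (Sum.inr y) = v at *
      have h5 := val_swap_cases a b u
      have h6 := val_swap_cases b c (Equiv.swap a b u)
      rw [Equiv.Perm.mul_apply]
      generalize Equiv.swap a b u = t at *
      generalize Equiv.swap b c t = w at *
      refine Fin.ext ?_
      omega
  · replace hi : (s i).1 = i.1 := by omega
    refine ⟨Equiv.swap a b, ?_, fun x => ?_, fun y => ?_⟩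
    · rw [Equiv.Perm.sign_swap hab, hi]
      simp
    · obtain ⟨x, hxi⟩ := x
      have h1 := Graft.std_inl_cases (n := 1) i rfl x hxi
      have h2 := Graft.std_inl_cases (n := 1) (s i) rfl (s x) (hsx ⟨x, hxi⟩)
      have h3 := val_swap_cases j.castSucc j.succ x
      have h4 : x.1 ≠ i.1 := fun h => hxi (Fin.ext h)
      rw [← hs] at h3
      generalize Graft.std (n := 1) i rfl (Sum.inl ⟨x, hxi⟩) = u at *
      generalize Graft.std (n := 1) (s i) rfl (Sum.inl ⟨s x, hsx ⟨x, hxi⟩⟩) = v at *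
      generalize s x = z at *
      have h5 := val_swap_cases a b u
      generalize Equiv.swap a b u = w at *
      refine Fin.ext ?_
      omega
    · have h1 := Graft.std_inr (n := 1) i rfl y
      have h2 := Graft.std_inr (n := 1) (s i) rfl y
      generalize Graft.std (n := 1) i rfl (Sum.inr y) = u at *
      generalize Graft.std (n := 1) (s i) rfl (Sum.inr y) = v at *
      have h5 := val_swap_cases a b u
      generalize Equiv.swap a b u = w at *
      refine Fin.ext ?_
      omega

namespace QuadraticData

variable {k : Type u} [Field k] {D : QuadraticData k} (A : D.operad.Alg)

theorem preComp_tmul {m n N : ℕ} (i : Fin m) (e : Graft i n N)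
    (φ : (endOperad k A.carrier).obj m) (p : D.dual.obj m)
    (ψ : (endOperad k A.carrier).obj n) (q : D.dual.obj n) :
    preComp A i e (φ ⊗ₜ[k] p) (ψ ⊗ₜ[k] q) =
      ((endOperad k A.carrier).comp i e φ ψ) ⊗ₜ[k] (D.dual.comp i e p q) :=
  rfl

theorem preRelabel_preComp {m n N M : ℕ} (i : Fin m) (e : Graft i n N) (ρ : Fin N ≃ Fin M)
    (f : D.Pre A m) (g : D.Pre A n) :
    preRelabel A ρ (preComp A i e f g) = preComp A i (e.trans ρ) f g := by
  have h : (preComp A i e).compr₂ (preRelabel A ρ) = preComp (D := D) A i (e.trans ρ) := by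
    refine TensorProduct.ext' fun φ p => TensorProduct.ext' fun ψ q => ?_
    simp only [LinearMap.compr₂_apply, preComp_tmul, preRelabel_tmul, Operad.relabel_comp]
  exact LinearMap.congr_fun (LinearMap.congr_fun h f) g

theorem preComp_preRelabel {m m' n N : ℕ} (i : Fin m) (σ : Fin m ≃ Fin m')
    (e : Graft i n N) (e' : Graft (σ i) n N)
    (h : ∀ x : {x : Fin m // x ≠ i},
      e' (Sum.inl ⟨σ x, fun h => x.2 (σ.injective h)⟩) = e (Sum.inl x))
    (h' : ∀ y : Fin n, e' (Sum.inr y) = e (Sum.inr y)) (f : D.Pre A m) (g : D.Pre A n) :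
    preComp A (σ i) e' (preRelabel A σ f) g = preComp A i e f g := by
  have key : (preComp A (σ i) e').comp (preRelabel A σ) = preComp (D := D) A i e := by
    refine TensorProduct.ext' fun φ p => TensorProduct.ext' fun ψ q => ?_
    simp only [LinearMap.comp_apply, preComp_tmul, preRelabel_tmul]
    congr 1
    · conv_lhs => rw [← (endOperad k A.carrier).relabel_refl ψ]
      exact (endOperad k A.carrier).comp_relabel i σ (Equiv.refl _) e e' h h' φ ψ
    · conv_lhs => rw [← D.dual.relabel_refl q]
      exact D.dual.comp_relabel i σ (Equiv.refl _) e e' h h' p q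
  exact LinearMap.congr_fun (LinearMap.congr_fun key f) g

theorem twist_one {n : ℕ} (f : D.Pre A n) : twist A (1 : Equiv.Perm (Fin n)) f = f := by
  have h : preRelabel A (1 : Equiv.Perm (Fin n)) = (LinearMap.id : D.Pre A n →ₗ[k] D.Pre A n) := by
    refine TensorProduct.ext' fun φ q => ?_
    rw [preRelabel_tmul]
    exact congrArg₂ _ ((endOperad k A.carrier).relabel_refl φ) (D.dual.relabel_refl q)
  simp [twist, h]

theorem averEnd_preRelabel {n : ℕ} (σ : Equiv.Perm (Fin n)) (f : D.Pre A n) :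
    averEnd A n (preRelabel A σ f) = ((Equiv.Perm.sign σ : ℤ) : k) • averEnd A n f := by
  have hs : (((Equiv.Perm.sign σ : ℤ) : k)) * ((Equiv.Perm.sign σ : ℤ) : k) = 1 := by
    rw [← Int.cast_mul, Int.units_coe_mul_self, Int.cast_one]
  have h : averEnd A n (twist A σ f) = averEnd A n f := by
    simp only [averEnd, LinearMap.smul_apply, LinearMap.sum_apply, twist_twist]
    congr 1
    exact Fintype.sum_equiv (Equiv.mulRight σ) _ _ fun ρ => rfl
  rw [← h, twist, LinearMap.smul_apply, map_smul, smul_smul, hs, one_smul]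

theorem preLie_one_apply {m : ℕ} (f : D.Pre A (m + 1)) (g : D.Pre A 2) :
    preLie A (m := m) (n := 1) rfl f g =
      ∑ i : Fin (m + 1), (-1 : k) ^ i.1 • preComp A i (Graft.std (n := 1) i rfl) f g := by
  simp only [preLie, LinearMap.sum_apply, LinearMap.smul_apply, one_mul]

theorem averEnd_preComp_swap {m : ℕ} (j : Fin m) (i : Fin (m + 1)) (s : Equiv.Perm (Fin (m + 1)))
    (hs : s = Equiv.swap j.castSucc j.succ) (f : D.Pre A (m + 1)) (g : D.Pre A 2) :
    (-1 : k) ^ (s i).1 •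
      averEnd A (m + 2) (preComp A (s i) (Graft.std (n := 1) (s i) rfl) (twist A s f) g) =
    (-1 : k) ^ i.1 • averEnd A (m + 2) (preComp A i (Graft.std (n := 1) i rfl) f g) := by
  have hne : j.castSucc ≠ j.succ := (Fin.castSucc_lt_succ).ne
  obtain ⟨ρ, hρ, h, h'⟩ := Graft.exists_perm_std_swap j i s hs
  have hsign : Equiv.Perm.sign s = -1 := by rw [hs, Equiv.Perm.sign_swap hne]
  have hρ' := congrArg (Int.cast : ℤ → k) hρ
  push_cast at hρ'
  rw [twist, hsign, LinearMap.smul_apply, map_smul, LinearMap.smul_apply, map_smul,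
    preComp_preRelabel A i s ((Graft.std (n := 1) i rfl).trans ρ) _ h h', ← preRelabel_preComp,
    averEnd_preRelabel, smul_smul, smul_smul, ← hρ']
  simp

/-- After averaging, the pre-Lie product depends only on the coinvariant class of its first factor. -/
theorem averEnd_preLie_twist {m : ℕ} (σ : Equiv.Perm (Fin (m + 1))) (f : D.Pre A (m + 1))
    (g : D.Pre A 2) :
    averEnd A (m + 2) (preLie A (m := m) (n := 1) rfl (twist A σ f) g) =
      averEnd A (m + 2) (preLie A (m := m) (n := 1) rfl f g) := by
  have hσ : σ ∈ Submonoid.closure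
      (Set.range fun j : Fin m => Equiv.swap j.castSucc j.succ) := by
    rw [Equiv.Perm.mclosure_swap_castSucc_succ]
    trivial
  induction hσ using Submonoid.closure_induction generalizing f with
  | mem _ h =>
    obtain ⟨j, rfl⟩ := h
    simp only [preLie_one_apply, map_sum, map_smul]
    rw [← Equiv.sum_comp (Equiv.swap j.castSucc j.succ)]
    exact Finset.sum_congr rfl fun i _ => averEnd_preComp_swap A j i _ rfl f g
  | one =>
    rw [twist_one]
  | mul σ ρ _ _ hσ hρ => rw [← twist_twist, hσ, hρ]

end QuadraticData

/-! ### The test algebra -/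

namespace QuadraticData

variable {k : Type u} [Field k]

theorem sum_coord_smul {E W : Type*} [AddCommGroup E] [Module k E] [AddCommGroup W] [Module k W]
    {ι : Type*} [Fintype ι] [DecidableEq ι] (b : Module.Basis ι k E) (c : Module.Dual k E)
    (F : Module.Dual k E →ₗ[k] W) : ∑ i, c (b i) • F (b.coord i) = F c := by
  simp only [← map_smul, ← map_sum]
  congr 1
  refine b.ext fun j => ?_
  simp

theorem dualGen_dualτ (D : QuadraticData k) (l : Module.Dual k D.E) :
    D.dualGen (D.dualτ l) = D.dual.relabel (Equiv.swap 0 1) (D.dualGen l) := by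
  have h : freeGen D.dualτ (D.dualτ l) =
      (freeOperad D.dualτ).relabel (Equiv.swap 0 1) (freeGen D.dualτ l) :=
    Quot.sound (.gen_swap l)
  exact (congrArg (((freeOperad D.dualτ).toModRel D.dualR).toFun 2) h).trans
    (((freeOperad D.dualτ).toModRel D.dualR).map_relabel _ _)

variable (D : QuadraticData k)

/-- The underlying space of the test algebra. It has vectors `v₀, v₁, …`, a copy of `E`, in which
the products of `v₀` and `v₁` take their values, and one more vector `u`, to serve as the value of a
cochain. -/
abbrev TestSpace : Type u := (ℕ → k) × D.E × k

/-- A product of linear forms in the different arguments. -/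
noncomputable def prodForm {V : Type u} [AddCommGroup V] [Module k V] {n : ℕ}
    (a : Fin n → Module.Dual k V) : MultilinearMap k (fun _ : Fin n => V) k :=
  (MultilinearMap.mkPiAlgebra k (Fin n) k).compLinearMap a

theorem prodForm_apply {V : Type u} [AddCommGroup V] [Module k V] {n : ℕ}
    (a : Fin n → Module.Dual k V) (x : Fin n → V) : prodForm a x = ∏ i, a i (x i) := rfl

/-- The coordinate along `v_j`. -/
def testCoord (j : ℕ) : Module.Dual k D.TestSpace :=
  LinearMap.proj j ∘ₗ LinearMap.fst k (ℕ → k) (D.E × k)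

/-- The product `a b = a⁰ b¹ e + a¹ b⁰ e'`, where `a^j` is the coordinate of `a` along `v_j`. -/
noncomputable def pairProduct (e e' : D.E) :
    MultilinearMap k (fun _ : Fin 2 => D.TestSpace) D.TestSpace :=
  (prodForm ![D.testCoord 0, D.testCoord 1]).smulRight (0, e, 0) +
    (prodForm ![D.testCoord 1, D.testCoord 0]).smulRight (0, e', 0)

theorem pairProduct_apply (e e' : D.E) (x : Fin 2 → D.TestSpace) :
    D.pairProduct e e' x =
      (0, ((x 0).1 0 * (x 1).1 1) • e + ((x 0).1 1 * (x 1).1 0) • e', 0) := by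
  change prodForm ![D.testCoord 0, D.testCoord 1] x • ((0, e, 0) : D.TestSpace) +
    prodForm ![D.testCoord 1, D.testCoord 0] x • ((0, e', 0) : D.TestSpace) = _
  simp only [prodForm_apply, Fin.prod_univ_two]
  simp [testCoord]

/-- The products of the test algebra: `e(a, b)` depends only on the coordinates of `a` and `b` along
`v₀` and `v₁`, with `e(v₀, v₁) = e` and `e(v₁, v₀) = τ e`. -/
noncomputable def testProduct : D.E →ₗ[k] (endOperad k D.TestSpace).obj 2 where
  toFun e := D.pairProduct e (D.τ e)
  map_add' e e' := by
    refine MultilinearMap.ext fun x => ?_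
    change D.pairProduct _ _ x = D.pairProduct _ _ x + D.pairProduct _ _ x
    simp only [pairProduct_apply, map_add, smul_add, Prod.mk_add_mk, add_zero]
    rw [add_add_add_comm]
  map_smul' c e := by
    refine MultilinearMap.ext fun x => ?_
    change D.pairProduct _ _ x = c • D.pairProduct _ _ x
    simp only [pairProduct_apply, map_smul, smul_add, Prod.smul_mk, smul_zero]
    rw [smul_comm c, smul_comm c]

theorem testProduct_apply (e : D.E) (x : Fin 2 → D.TestSpace) :
    NatTree.asMap (D.testProduct e) x =
      (0, ((x 0).1 0 * (x 1).1 1) • e + ((x 0).1 1 * (x 1).1 0) • D.τ e, 0) :=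
  D.pairProduct_apply e (D.τ e) x

theorem testProduct_eq_zero (e : D.E) (x : Fin 2 → D.TestSpace) (i : Fin 2) (h : (x i).1 = 0) :
    NatTree.asMap (D.testProduct e) x = 0 := by
  rw [testProduct_apply]
  have : i = 0 ∨ i = 1 := by omega
  rcases this with rfl | rfl <;> simp [h]

theorem testProduct_comp_eq_zero {n N : ℕ} (i : Fin 2) (l : Graft i n N) (e : D.E)
    (ψ : (endOperad k D.TestSpace).obj n) (h : ∀ x, (NatTree.asMap ψ x).1 = 0) :
    (endOperad k D.TestSpace).comp i l (D.testProduct e) ψ = 0 := by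
  refine MultilinearMap.ext fun x => ?_
  refine D.testProduct_eq_zero e _ i ?_
  simp only [Graft.args, dite_true]
  exact h _

theorem testProduct_τ (e : D.E) :
    D.testProduct (D.τ e) = (endOperad k D.TestSpace).relabel (Equiv.swap 0 1) (D.testProduct e) := by
  have hτ : D.τ (D.τ e) = e := LinearMap.congr_fun D.τ_comp_τ e
  refine MultilinearMap.ext fun x => ?_
  refine (D.testProduct_apply (D.τ e) x).trans
    (Eq.trans ?_ (D.testProduct_apply e fun i => x (Equiv.swap 0 1 i)).symm)
  rw [hτ, Equiv.swap_apply_left, Equiv.swap_apply_right, add_comm]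
  simp only [mul_comm]

theorem exists_testAction : ∃ F : D.operad.Hom (endOperad k D.TestSpace),
    ∀ e, F.toFun 2 (D.gen e) = D.testProduct e :=
  exists_hom_of_comp_eq_zero D.R (endOperad k D.TestSpace) D.testProduct D.testProduct_τ
    fun i l x y => D.testProduct_comp_eq_zero i l x _ fun z => by rw [testProduct_apply]

/-- The test algebra. All iterated products vanish in it, so that it is an algebra over every
quadratic operad generated by `E`. -/
noncomputable def testAlgebra : D.operad.Alg where
  carrier := D.TestSpace
  act := D.exists_testAction.choose

/-- The action of the generators on the test algebra. -/
noncomputable def testGen : D.E →ₗ[k] (endOperad k D.testAlgebra.carrier).obj 2 :=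
  D.testAlgebra.act.toFun 2 ∘ₗ D.gen

theorem testGen_eq (e : D.E) : D.testGen e = D.testProduct e :=
  D.exists_testAction.choose_spec e

variable {D}

/-- The multilinear form `a₀, …, a_m ↦ l(a₀) a₁² ⋯ a_m^{m+1}`, where `l` is applied to the component
of `a₀` in `E` and `a^j` is the coordinate of `a` along `v_j`. -/
noncomputable def testForm (l : Module.Dual k D.E) (m : ℕ) :
    MultilinearMap k (fun _ : Fin (m + 1) => D.TestSpace) k :=
  prodForm (Fin.cons (l ∘ₗ LinearMap.fst k D.E k ∘ₗ LinearMap.snd k (ℕ → k) (D.E × k))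
    fun j : Fin m => D.testCoord (j + 2))

theorem testForm_apply (l : Module.Dual k D.E) (m : ℕ) (x : Fin (m + 1) → D.TestSpace) :
    testForm l m x = l (x 0).2.1 * ∏ j : Fin m, (x j.succ).1 (j + 2) := by
  rw [testForm, prodForm_apply, Fin.prod_univ_succ]
  simp [testCoord]

/-- The test form, with values in the line spanned by `u`. -/
noncomputable def testMap (l : Module.Dual k D.E) (m : ℕ) :
    (endOperad k D.testAlgebra.carrier).obj (m + 1) :=
  (testForm l m).smulRight ((0, 0, 1) : D.TestSpace)

theorem testMap_apply (l : Module.Dual k D.E) (m : ℕ) (x : Fin (m + 1) → D.TestSpace) :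
    (NatTree.asMap (testMap l m) x : D.TestSpace) = testForm l m x • ((0, 0, 1) : D.TestSpace) :=
  rfl

/-- The vector `v_j` of the test algebra. -/
def testVector (D : QuadraticData k) (j : ℕ) : D.TestSpace := (Pi.single j 1, 0, 0)

/-- The coefficient of `u` in the value of a multilinear map at
`v₀, …, v_{n-1}`. -/
noncomputable def testCoeff (n : ℕ) : (endOperad k D.testAlgebra.carrier).obj n →ₗ[k] k where
  toFun φ := (show D.TestSpace from NatTree.asMap φ fun j => D.testVector j).2.2
  map_add' _ _ := rfl
  map_smul' _ _ := rfl

/-- The coefficient in `P^!` of the evaluation of an operation at `v₀, …, v_{n-1}`. -/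
noncomputable def testRead (n : ℕ) : D.Pre D.testAlgebra n →ₗ[k] D.dual.obj n :=
  (TensorProduct.lid k (D.dual.obj n)).toLinearMap ∘ₗ TensorProduct.map (testCoeff n) LinearMap.id

theorem testRead_tmul {n : ℕ} (φ : (endOperad k D.testAlgebra.carrier).obj n)
    (q : D.dual.obj n) : testRead n (φ ⊗ₜ[k] q) = testCoeff n φ • q := by
  simp [testRead]

theorem testRead_map {n : ℕ} (Φ : Module.End k (D.dual.obj n)) (f : D.Pre D.testAlgebra n) :
    testRead n (TensorProduct.map LinearMap.id Φ f) = Φ (testRead n f) := by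
  have h : testRead n ∘ₗ TensorProduct.map LinearMap.id Φ = Φ ∘ₗ testRead (D := D) n := by
    refine TensorProduct.ext' fun φ q => ?_
    simp [testRead_tmul]
  exact LinearMap.congr_fun h f

theorem chi_eq_sum (A : D.operad.Alg) : chi A =
    ∑ i, (A.act.toFun 2 (D.gen (Module.Basis.ofVectorSpace k D.E i))) ⊗ₜ[k]
      (D.dualGen ((Module.Basis.ofVectorSpace k D.E).coord i)) := by
  simp only [chi, coevaluation_apply_one, map_sum, TensorProduct.map_tmul]
  rfl

/-- Since `χ` corresponds to the identity of `E`, pairing its `P`-factor with a functional on `E` turns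
its `P^!`-factor into that functional. -/
theorem testRead_preRelabel_preComp_chi {n N : ℕ} (i : Fin n) (e : Graft i 2 N)
    (ρ : Equiv.Perm (Fin N)) (φ : (endOperad k D.testAlgebra.carrier).obj n) (q : D.dual.obj n) :
    testRead N (preRelabel D.testAlgebra ρ
      (preComp D.testAlgebra i e (φ ⊗ₜ[k] q) (chi D.testAlgebra))) =
    D.dual.relabel ρ (D.dual.comp i e q (D.dualGen (testCoeff N ∘ₗ
      (endOperad k D.testAlgebra.carrier).relabel ρ ∘ₗ
        (endOperad k D.testAlgebra.carrier).comp i e φ ∘ₗ D.testGen))) := by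
  classical
  rw [chi_eq_sum]
  simp only [map_sum, preComp_tmul, preRelabel_tmul, testRead_tmul]
  exact sum_coord_smul (Module.Basis.ofVectorSpace k D.E)
    (testCoeff N ∘ₗ (endOperad k D.testAlgebra.carrier).relabel ρ ∘ₗ
      (endOperad k D.testAlgebra.carrier).comp i e φ ∘ₗ D.testGen)
    (D.dual.relabel ρ ∘ₗ D.dual.comp i e q ∘ₗ D.dualGen)

theorem testCoeff_comp_testMap {m : ℕ} (l : Module.Dual k D.E) (i : Fin (m + 1))
    (e : Graft i 2 (m + 2)) (ρ : Equiv.Perm (Fin (m + 2))) (x : D.E) (v : Fin (m + 1) → D.TestSpace)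
    (hv : v = e.args (fun j => D.testVector (ρ j))
      (NatTree.asMap (D.testProduct x) fun y => D.testVector (ρ (e (Sum.inr y))))) :
    testCoeff (m + 2) ((endOperad k D.testAlgebra.carrier).relabel ρ
      ((endOperad k D.testAlgebra.carrier).comp i e (testMap l m) (D.testGen x))) =
    l (v 0).2.1 * ∏ j : Fin m, (v j.succ).1 (j + 2) := by
  rw [testGen_eq, hv]
  refine (congrArg (fun y : D.TestSpace => y.2.2) (testMap_apply l m _)).trans ?_
  exact (mul_one _).trans (testForm_apply l m _)

theorem testCoeff_comp_testMap_of_ne {m : ℕ} (l : Module.Dual k D.E) (i : Fin (m + 1))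
    (hi : i ≠ 0) (e : Graft i 2 (m + 2)) (ρ : Equiv.Perm (Fin (m + 2))) (x : D.E) :
    testCoeff (m + 2) ((endOperad k D.testAlgebra.carrier).relabel ρ
      ((endOperad k D.testAlgebra.carrier).comp i e (testMap l m) (D.testGen x))) = 0 := by
  rw [testCoeff_comp_testMap l i e ρ x _ rfl]
  simp [Graft.args, hi.symm, testVector]

theorem std_zero_inr {m : ℕ} (y : Fin 2) :
    Graft.std (m := m) (n := 1) (N := m + 1) 0 rfl (Sum.inr y) = Fin.castLE (by omega) y :=
  Fin.ext (by rw [Graft.std_inr]; simp)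

theorem std_zero_inl {m : ℕ} (j : Fin m) :
    Graft.std (m := m) (n := 1) (N := m + 1) 0 rfl (Sum.inl ⟨j.succ, Fin.succ_ne_zero j⟩) =
      j.succ.succ :=
  Fin.ext (by rw [Graft.std_inl]; simp)

theorem testCoeff_comp_testMap_zero {m : ℕ} (l : Module.Dual k D.E)
    (ρ : Equiv.Perm (Fin (m + 2))) (x : D.E) :
    testCoeff (m + 2) ((endOperad k D.testAlgebra.carrier).relabel ρ
      ((endOperad k D.testAlgebra.carrier).comp 0 (Graft.std (n := 1) 0 rfl) (testMap l m)
        (D.testGen x))) =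
    l (((if ρ 0 = 0 then 1 else 0) * (if ρ 1 = 1 then 1 else 0) : k) • x +
        ((if ρ 0 = 1 then 1 else 0) * (if ρ 1 = 0 then 1 else 0) : k) • D.τ x) *
      ∏ j : Fin m, (if ρ j.succ.succ = j.succ.succ then 1 else 0) := by
  rw [testCoeff_comp_testMap l 0 _ ρ x _ rfl]
  have h0 : (Fin.castLE (by omega) (0 : Fin 2) : Fin (m + 2)) = 0 := rfl
  have h1 : (Fin.castLE (by omega) (1 : Fin 2) : Fin (m + 2)) = 1 := rfl
  congr 1
  · simp only [Graft.args, dite_true, testProduct_apply, std_zero_inr, h0, h1, testVector,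
      Pi.single_apply, Fin.ext_iff, Fin.val_zero, Fin.val_one, eq_comm (a := (0 : ℕ)),
      eq_comm (a := (1 : ℕ))]
  · refine Finset.prod_congr rfl fun j _ => ?_
    simp only [Graft.args, Fin.succ_ne_zero, dite_false, std_zero_inl, testVector, Pi.single_apply]
    simp only [Fin.ext_iff, Fin.val_succ, eq_comm (a := j.1 + 2)]

theorem perm_eq_one_or_swap {m : ℕ} (ρ : Equiv.Perm (Fin (m + 2)))
    (h : ∀ j : Fin m, ρ j.succ.succ = j.succ.succ) : ρ = 1 ∨ ρ = Equiv.swap 0 1 := by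
  have h01 : ∀ x : Fin (m + 2), x ≠ 0 → x ≠ 1 → ρ x = x := by
    intro x hx hx'
    obtain ⟨y, rfl⟩ := Fin.exists_succ_eq.2 hx
    obtain ⟨z, rfl⟩ := Fin.exists_succ_eq.2 (fun hy : y = 0 => hx' (by rw [hy]; rfl))
    exact h z
  have h0 : ρ 0 = 0 ∨ ρ 0 = 1 := by
    by_contra hc
    push Not at hc
    exact hc.1 (ρ.injective (h01 _ hc.1 hc.2))
  have h1 : ρ 1 = 0 ∨ ρ 1 = 1 := by
    by_contra hc
    push Not at hc
    exact hc.2 (ρ.injective (h01 _ hc.1 hc.2))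
  have hne : ρ 0 ≠ ρ 1 := fun he => absurd (ρ.injective he) (by simp)
  rcases h0 with h0 | h0
  · refine Or.inl (Equiv.ext fun x => ?_)
    by_cases hx : x = 0
    · rw [hx, h0]; rfl
    by_cases hx' : x = 1
    · rw [hx', h1.resolve_left fun h => hne (h0.trans h.symm)]; rfl
    exact h01 x hx hx'
  · refine Or.inr (Equiv.ext fun x => ?_)
    by_cases hx : x = 0
    · rw [hx, h0, Equiv.swap_apply_left]
    by_cases hx' : x = 1
    · rw [hx', h1.resolve_right fun h => hne (h0.trans h.symm), Equiv.swap_apply_right]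
    rw [h01 x hx hx', Equiv.swap_apply_of_ne_of_ne hx hx']

/-- Because of the twist by the sign in `E^∨`, exchanging the two inputs of the generator changes the
sign of its dual. -/
theorem relabel_swap_comp_dualGen {m : ℕ} (q : D.dual.obj (m + 1)) (l : Module.Dual k D.E) :
    D.dual.relabel (Equiv.swap 0 1) (D.dual.comp 0 (Graft.std (N := m + 1) 0 rfl) q
      (D.dualGen (l ∘ₗ D.τ))) =
    -D.dual.comp 0 (Graft.std (N := m + 1) 0 rfl) q (D.dualGen l) := by
  have h : D.dualGen (l ∘ₗ D.τ) = -D.dual.relabel (Equiv.swap 0 1) (D.dualGen l) := by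
    rw [← dualGen_dualτ, ← map_neg]
    congr 1
    simp [dualτ]
    rfl
  rw [h, map_neg, map_neg, Operad.relabel_comp]
  congr 1
  conv_lhs => rw [← D.dual.relabel_refl q]
  refine D.dual.comp_relabel 0 (Equiv.refl _) (Equiv.swap 0 1) _ _ (fun x => ?_) (fun y => ?_) q
    (D.dualGen l)
  · obtain ⟨x, hx⟩ := x
    obtain ⟨j, rfl⟩ := Fin.exists_succ_eq.2 hx
    refine (congrArg (Equiv.swap 0 1) (std_zero_inl j)).trans
      (Eq.trans ?_ (std_zero_inl j).symm)
    exact Equiv.swap_apply_of_ne_of_ne (Fin.succ_ne_zero _) (fun h => Fin.succ_ne_zero j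
      (Fin.succ_injective _ h))
  · change Equiv.swap 0 1 (Graft.std (m := m) (n := 1) (N := m + 1) 0 rfl
      (Sum.inr (Equiv.swap 0 1 y))) =
        Graft.std (m := m) (n := 1) (N := m + 1) 0 rfl (Sum.inr y)
    rw [std_zero_inr, std_zero_inr]
    have : y = 0 ∨ y = 1 := by omega
    rcases this with rfl | rfl
    · rw [Equiv.swap_apply_left]
      exact Equiv.swap_apply_right _ _
    · rw [Equiv.swap_apply_right]
      exact Equiv.swap_apply_left _ _

theorem testRead_twist_one {m : ℕ} (l : Module.Dual k D.E) (q : D.dual.obj (m + 1)) :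
    testRead (m + 2) (twist D.testAlgebra (1 : Equiv.Perm (Fin (m + 2)))
      (preComp D.testAlgebra 0 (Graft.std (N := m + 1) 0 rfl) (testMap l m ⊗ₜ[k] q)
        (chi D.testAlgebra))) =
      D.dual.comp 0 (Graft.std (N := m + 1) 0 rfl) q (D.dualGen l) := by
  rw [twist, Equiv.Perm.sign_one, LinearMap.smul_apply, map_smul,
    testRead_preRelabel_preComp_chi]
  rw [show (testCoeff (m + 2) ∘ₗ (endOperad k D.testAlgebra.carrier).relabel 1 ∘ₗ
    (endOperad k D.testAlgebra.carrier).comp 0 (Graft.std (n := 1) 0 rfl) (testMap l m) ∘ₗ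
      D.testGen) = l from LinearMap.ext fun x => by
      refine (testCoeff_comp_testMap_zero l 1 x).trans ?_
      simp]
  simp only [Units.val_one, Int.cast_one, one_smul]
  exact D.dual.relabel_refl _

theorem testRead_twist_swap {m : ℕ} (l : Module.Dual k D.E) (q : D.dual.obj (m + 1)) :
    testRead (m + 2) (twist D.testAlgebra (Equiv.swap (0 : Fin (m + 2)) 1)
      (preComp D.testAlgebra 0 (Graft.std (N := m + 1) 0 rfl) (testMap l m ⊗ₜ[k] q)
        (chi D.testAlgebra))) =
      D.dual.comp 0 (Graft.std (N := m + 1) 0 rfl) q (D.dualGen l) := by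
  rw [twist, Equiv.Perm.sign_swap (by simp), LinearMap.smul_apply, map_smul,
    testRead_preRelabel_preComp_chi]
  rw [show (testCoeff (m + 2) ∘ₗ (endOperad k D.testAlgebra.carrier).relabel (Equiv.swap 0 1) ∘ₗ
    (endOperad k D.testAlgebra.carrier).comp 0 (Graft.std (n := 1) 0 rfl) (testMap l m) ∘ₗ
      D.testGen) = l ∘ₗ D.τ from LinearMap.ext fun x => by
      refine (testCoeff_comp_testMap_zero l _ x).trans ?_
      have h : ∀ j : Fin m, Equiv.swap (0 : Fin (m + 2)) 1 j.succ.succ = j.succ.succ := fun j =>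
        Equiv.swap_apply_of_ne_of_ne (Fin.succ_ne_zero _) fun h => Fin.succ_ne_zero j
          (Fin.succ_injective _ h)
      simp [h]]
  rw [relabel_swap_comp_dualGen]
  simp

theorem testRead_twist_of_ne {m : ℕ} (l : Module.Dual k D.E) (q : D.dual.obj (m + 1))
    (ρ : Equiv.Perm (Fin (m + 2))) (h : ρ ≠ 1 ∧ ρ ≠ Equiv.swap 0 1) :
    testRead (m + 2) (twist D.testAlgebra ρ
      (preComp D.testAlgebra 0 (Graft.std (N := m + 1) 0 rfl) (testMap l m ⊗ₜ[k] q)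
        (chi D.testAlgebra))) = 0 := by
  have hj : ∃ j : Fin m, ρ j.succ.succ ≠ j.succ.succ := by
    by_contra! hc
    exact (perm_eq_one_or_swap ρ hc).elim h.1 h.2
  obtain ⟨j, hj⟩ := hj
  rw [twist, LinearMap.smul_apply, map_smul, testRead_preRelabel_preComp_chi]
  rw [show (testCoeff (m + 2) ∘ₗ (endOperad k D.testAlgebra.carrier).relabel ρ ∘ₗ
    (endOperad k D.testAlgebra.carrier).comp 0 (Graft.std (n := 1) 0 rfl) (testMap l m) ∘ₗ
      D.testGen) = 0 from LinearMap.ext fun x => by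
      refine (testCoeff_comp_testMap_zero l _ x).trans ?_
      rw [Finset.prod_eq_zero (Finset.mem_univ j) (if_neg hj), mul_zero]
      rfl]
  simp

/-- Evaluation at `v₀, …, v_{m+1}` isolates one composition. The test form needs an argument in `E` at
its first input, and this can only be a product of `v₀` and `v₁`; so only the composition at the
first input contributes, relabelled by the identity or by the exchange of `v₀` and `v₁`. The two
terms are equal. -/
theorem testRead_averEnd_preLie {m : ℕ} (l : Module.Dual k D.E) (q : D.dual.obj (m + 1)) :
    testRead (m + 2) (averEnd D.testAlgebra (m + 2)
      (preLie D.testAlgebra (m := m) (n := 1) rfl (testMap l m ⊗ₜ[k] q) (chi D.testAlgebra))) =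
      (((m + 2).factorial : k)⁻¹ * 2) •
        D.dual.comp 0 (Graft.std (N := m + 1) 0 rfl) q (D.dualGen l) := by
  rw [preLie_one_apply, map_sum, map_sum, Finset.sum_eq_single 0]
  · simp only [Fin.val_zero, pow_zero, one_smul, averEnd, LinearMap.smul_apply,
      LinearMap.sum_apply, map_smul, map_sum]
    rw [Finset.sum_eq_add (1 : Equiv.Perm (Fin (m + 2))) (Equiv.swap 0 1)
      (fun h => absurd (congrArg (fun ρ : Equiv.Perm (Fin (m + 2)) => ρ 0) h) (by simp))
      (fun ρ _ h => testRead_twist_of_ne l q ρ h) (fun h => absurd (Finset.mem_univ _) h)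
      (fun h => absurd (Finset.mem_univ _) h), testRead_twist_one, testRead_twist_swap, mul_smul,
      two_smul]
  · intro i _ hi
    rw [map_smul, map_smul]
    simp only [averEnd, LinearMap.smul_apply, LinearMap.sum_apply, map_smul, map_sum]
    rw [Finset.sum_eq_zero fun ρ _ => ?_, smul_zero, smul_zero]
    rw [twist, LinearMap.smul_apply, map_smul, testRead_preRelabel_preComp_chi]
    rw [show (testCoeff (m + 2) ∘ₗ (endOperad k D.testAlgebra.carrier).relabel ρ ∘ₗ
      (endOperad k D.testAlgebra.carrier).comp i (Graft.std (n := 1) i rfl) (testMap l m) ∘ₗ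
        D.testGen) = 0 from LinearMap.ext fun x => testCoeff_comp_testMap_of_ne l i hi _ ρ x]
    simp
  · exact fun h => absurd (Finset.mem_univ _) h

end QuadraticData

/-! ### Degree zero cocycles are scalars -/

namespace QuadraticData

variable {k : Type u} [Field k] {D : QuadraticData k}

theorem preComp_chi_testMap {m N : ℕ} (i : Fin 2) (e : Graft i (m + 1) N)
    (σ : Equiv.Perm (Fin (m + 1))) (l : Module.Dual k D.E) (q : D.dual.obj (m + 1)) :
    preComp D.testAlgebra i e (chi D.testAlgebra)
      (preRelabel D.testAlgebra σ (testMap l m ⊗ₜ[k] q)) = 0 := by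
  rw [chi_eq_sum, preRelabel_tmul]
  simp only [map_sum, LinearMap.sum_apply, preComp_tmul]
  refine Finset.sum_eq_zero fun j _ => ?_
  have h : (endOperad k D.testAlgebra.carrier).comp i e
      (D.testAlgebra.act.toFun 2 (D.gen (Module.Basis.ofVectorSpace k D.E j)))
      ((endOperad k D.testAlgebra.carrier).relabel σ (testMap l m)) = 0 := by
    refine Eq.trans (congrArg (fun ψ => (endOperad k D.testAlgebra.carrier).comp i e ψ _)
      (D.testGen_eq _)) ?_
    exact D.testProduct_comp_eq_zero i e _ _ fun x => smul_zero (testForm l m _)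
  rw [h, TensorProduct.zero_tmul]

/-- The values of the test map annihilate the test algebra, so that only one half of the differential
contributes. -/
theorem preLie_chi_averEnd_testMap {m N : ℕ} (hN : 1 + m = N) (l : Module.Dual k D.E)
    (q : D.dual.obj (m + 1)) :
    preLie D.testAlgebra hN (chi D.testAlgebra)
      (averEnd D.testAlgebra (m + 1) (testMap l m ⊗ₜ[k] q)) = 0 := by
  simp only [averEnd, twist, LinearMap.smul_apply, LinearMap.sum_apply, map_smul, map_sum, preLie]
  refine (congrArg _ (Finset.sum_eq_zero fun σ _ => ?_)).trans (smul_zero _)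
  refine (congrArg _ (Finset.sum_eq_zero fun i _ => ?_)).trans (smul_zero _)
  exact (congrArg _ (preComp_chi_testMap i _ σ l q)).trans (smul_zero _)

theorem coe_circ (A : D.operad.Alg) {m n N : ℕ} (hN : m + n = N) (f : D.Pre A (m + 1))
    (g : D.Pre A (n + 1)) : (circ A hN f g : D.Pre A (N + 1)) =
      (((N + 1).factorial : k) / ((m + 1).factorial * (n + 1).factorial)) •
        averEnd A (N + 1) (preLie A hN f g) :=
  rfl

theorem averEnd_preLie_averEnd [CharZero k] (A : D.operad.Alg) {m : ℕ} (f : D.Pre A (m + 1))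
    (g : D.Pre A 2) :
    averEnd A (m + 2) (preLie A (m := m) (n := 1) rfl (averEnd A (m + 1) f) g) =
      averEnd A (m + 2) (preLie A (m := m) (n := 1) rfl f g) := by
  have h : averEnd A (m + 1) f = ((m + 1).factorial : k)⁻¹ • ∑ σ, twist A σ f := by
    simp only [averEnd, LinearMap.smul_apply, LinearMap.sum_apply]
  rw [h]
  simp only [LinearMap.smul_apply, LinearMap.sum_apply, map_smul, map_sum, averEnd_preLie_twist]
  rw [Finset.sum_const, Finset.card_univ, Fintype.card_perm, Fintype.card_fin,
    ← Nat.cast_smul_eq_nsmul k, smul_smul, inv_mul_cancel₀, one_smul]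
  exact_mod_cast Nat.factorial_ne_zero _

theorem coe_diff (A : D.operad.Alg) (m : ℕ) (f : Cochain A m) : (diff A m f : D.Pre A (m + 2)) =
    (circ A (Nat.add_comm 1 m) (chi A) f : D.Pre A (m + 2)) -
      (-1 : k) ^ m • (circ A (m := m) (n := 1) (N := m + 1) rfl f (chi A) : D.Pre A (m + 2)) :=
  rfl

/-- Every composition `q ∘₁ l` is read off from the coboundary of a cochain of the test algebra. -/
theorem exists_testRead_diff [CharZero k] {m : ℕ} (l : Module.Dual k D.E)
    (q : D.dual.obj (m + 1)) : ∃ f : Cochain D.testAlgebra m,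
      testRead (m + 2) (diff D.testAlgebra m f) =
        D.dual.comp 0 (Graft.std (N := m + 1) 0 rfl) q (D.dualGen l) := by
  obtain ⟨c, hc, h⟩ : ∃ c : k, c ≠ 0 ∧ testRead (m + 2)
      (diff D.testAlgebra m (aver D.testAlgebra m (testMap l m ⊗ₜ[k] q))) =
        c • D.dual.comp 0 (Graft.std (N := m + 1) 0 rfl) q (D.dualGen l) := by
    -- the sign and the normalization of `f ∘ χ`, times the factor left by the averaging
    refine ⟨-((-1 : k) ^ m * (((m + 2).factorial : k) / ((m + 1).factorial * (2).factorial) *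
      (((m + 2).factorial : k)⁻¹ * 2))), ?_, ?_⟩
    · have h1 : ((m + 2).factorial : k) ≠ 0 := by exact_mod_cast Nat.factorial_ne_zero _
      have h2 : ((m + 1).factorial : k) ≠ 0 := by exact_mod_cast Nat.factorial_ne_zero _
      have h3 : ((2).factorial : k) ≠ 0 := by exact_mod_cast Nat.factorial_ne_zero _
      have h4 : (2 : k) ≠ 0 := two_ne_zero
      have h5 : (-1 : k) ^ m ≠ 0 := pow_ne_zero _ (neg_ne_zero.2 one_ne_zero)
      exact neg_ne_zero.2 (mul_ne_zero h5 (mul_ne_zero (div_ne_zero h1 (mul_ne_zero h2 h3))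
        (mul_ne_zero (inv_ne_zero h1) h4)))
    · have haver : (aver D.testAlgebra m (testMap l m ⊗ₜ[k] q) : D.Pre D.testAlgebra (m + 1)) =
          averEnd D.testAlgebra (m + 1) (testMap l m ⊗ₜ[k] q) := rfl
      rw [coe_diff, coe_circ, coe_circ, haver, preLie_chi_averEnd_testMap, map_zero, smul_zero,
        zero_sub, averEnd_preLie_averEnd, map_neg, map_smul, map_smul, testRead_averEnd_preLie,
        smul_smul, smul_smul, neg_smul, mul_assoc]
  refine ⟨c⁻¹ • aver D.testAlgebra m (testMap l m ⊗ₜ[k] q), ?_⟩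
  rw [map_smul, Submodule.coe_smul, map_smul, h, smul_smul, inv_mul_cancel₀ hc, one_smul]

/-- The coboundaries of the test algebra detect the endomorphisms of `P^!(m+2)`. -/
theorem eq_zero_of_map_diff_eq_zero [CharZero k] {m : ℕ} (Ψ : Module.End k (D.dual.obj (m + 2)))
    (h : ∀ f : Cochain D.testAlgebra m,
      TensorProduct.map LinearMap.id Ψ (diff D.testAlgebra m f : D.Pre D.testAlgebra (m + 2)) = 0) :
    Ψ = 0 := by
  refine modRel_hom_ext fun ρ q l => ?_
  obtain ⟨f, hf⟩ := exists_testRead_diff l q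
  change Ψ (D.dual.relabel ρ (D.dual.comp 0 (Graft.std (N := m + 1) 0 rfl) q (D.dualGen l))) = 0
  -- by invariance, the relabelling by `ρ` may be moved to the multilinear factor,
  -- where it commutes with `Ψ`
  have h1 := map_relabel_id_eq ρ.symm (mem_cochain.1 (diff D.testAlgebra m f).2 ρ.symm)
  have h2 : TensorProduct.map LinearMap.id Ψ
      (TensorProduct.map ((endOperad k D.testAlgebra.carrier).relabel ρ.symm) LinearMap.id
        (diff D.testAlgebra m f : D.Pre D.testAlgebra (m + 2))) = 0 := by
    rw [← LinearMap.comp_apply, ← TensorProduct.map_comp, LinearMap.id_comp, LinearMap.comp_id]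
    have h3 : TensorProduct.map ((endOperad k D.testAlgebra.carrier).relabel ρ.symm) Ψ =
        TensorProduct.map ((endOperad k D.testAlgebra.carrier).relabel ρ.symm) LinearMap.id ∘ₗ
          TensorProduct.map LinearMap.id Ψ := by
      rw [← TensorProduct.map_comp, LinearMap.id_comp, LinearMap.comp_id]
    rw [h3, LinearMap.comp_apply, h, map_zero]
  rw [h1, map_smul] at h2
  have hs : ((Equiv.Perm.sign ρ.symm : ℤ) : k) ≠ 0 := by
    rcases Int.units_eq_one_or (Equiv.Perm.sign ρ.symm) with h | h <;> simp [h]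
  have h4 := congrArg (testRead (m + 2)) ((smul_eq_zero_iff_right hs).1 h2)
  rwa [testRead_map, testRead_map, hf, map_zero] at h4

theorem mem_B_zero_apply {U : D.Ambient} (hU : U ∈ D.B 0) (A : D.operad.Alg) (m : ℕ)
    (f : Cochain A m) : U A (incl A m f) = incl A m (D.component m m U A f) := by
  refine total_ext A fun m' => ?_
  by_cases h : m = m'
  · subst h
    exact (projection_incl A m _).symm
  · have h0 := congrFun ((mem_B.1 hU m m').2 (by simpa using fun h' : m' = m => h h'.symm)) A
    exact (LinearMap.congr_fun h0 f).trans (projection_incl_ne A h _).symm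

theorem dP_incl (A : D.operad.Alg) (m : ℕ) (f : Cochain A m) :
    D.dP A (incl A m f) = incl A (m + 1) (diff A m f) :=
  DirectSum.toModule_lof (M := fun m => Cochain A m)
    (φ := fun m => incl A (m + 1) ∘ₗ diff A m) k m f

theorem incl_injective (A : D.operad.Alg) (m : ℕ) : Function.Injective (incl A m) := fun f g h => by
  rw [← projection_incl A m f, h, projection_incl]

/-- A degree zero cocycle acts on all cochains as multiplication by the same scalar. -/
theorem exists_scalar [CharZero k] (z : D.Z0) : ∃ c : k, ∀ (m : ℕ) (A : D.operad.Alg)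
    (f : Cochain A m), (z : D.Ambient) A (incl A m f) = c • incl A m f := by
  obtain ⟨hB, hz⟩ := z.2
  have hcomm : D.dP * (z : D.Ambient) = (z : D.Ambient) * D.dP := by
    simpa [δ, sub_eq_zero] using hz
  have hΦ : ∀ m : ℕ, ∃ Φ : Module.End k (D.dual.obj (m + 1)), ∀ (A : D.operad.Alg)
      (f : Cochain A m), (D.component m m (z : D.Ambient) A f : D.Pre A (m + 1)) =
        TensorProduct.map LinearMap.id Φ (f : D.Pre A (m + 1)) := fun m =>
    exists_eq_map_of_mem_natural ((mem_B.1 hB m m).1 (by simp))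
  choose Φ hΦ using hΦ
  -- since `P^!(1)` is a line, the cocycle acts on `C^0` by a scalar
  obtain ⟨c, hc⟩ : ∃ c : k, c • D.dual.one = Φ 0 D.dual.one :=
    Submodule.mem_span_singleton.1 (mem_graftSpan (R := D.dualR) (n := 1) (Φ 0 D.dual.one))
  have key : ∀ m, Φ m = c • LinearMap.id → ∀ (A : D.operad.Alg) (f : Cochain A m),
      (z : D.Ambient) A (incl A m f) = c • incl A m f := by
    intro m hm A f
    rw [mem_B_zero_apply hB, ← map_smul]
    congr 1
    refine Subtype.ext ?_
    rw [hΦ, hm, TensorProduct.map_smul_right, TensorProduct.map_id]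
    rfl
  have hscalar : ∀ m, Φ m = c • LinearMap.id := by
    intro m
    induction m with
    | zero =>
      refine LinearMap.ext fun q => ?_
      obtain ⟨t, rfl⟩ : ∃ t : k, t • D.dual.one = q :=
        Submodule.mem_span_singleton.1 (mem_graftSpan (R := D.dualR) (n := 1) q)
      rw [map_smul, map_smul, ← hc]
      rfl
    | succ m ih =>
      refine sub_eq_zero.1 (eq_zero_of_map_diff_eq_zero _ fun f => ?_)
      have h1 := LinearMap.congr_fun (congrFun hcomm D.testAlgebra) (incl _ m f)
      change D.dP _ ((z : D.Ambient) _ (incl _ m f)) = (z : D.Ambient) _ (D.dP _ (incl _ m f)) at h1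
      rw [key m ih, map_smul, dP_incl, mem_B_zero_apply hB, ← map_smul] at h1
      have h2 := congrArg Subtype.val (incl_injective _ _ h1)
      rw [hΦ] at h2
      refine (LinearMap.congr_fun (LinearMap.lTensor_sub (Φ (m + 1)) (c • LinearMap.id))
        _).trans (sub_eq_zero.2 (h2.symm.trans ?_))
      rw [LinearMap.lTensor_smul, LinearMap.lTensor_id]
      rfl
  exact ⟨c, fun m => key m (hscalar m)⟩

theorem Z0_eq_algebraMap [CharZero k] (z : D.Z0) : ∃ c : k, z = algebraMap k D.Z0 c := by
  obtain ⟨c, hc⟩ := exists_scalar z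
  refine ⟨c, Subtype.ext (funext fun A => ?_)⟩
  exact DirectSum.linearMap_ext k fun m => LinearMap.ext fun f => hc m A f

theorem dual_one_ne_zero (D : QuadraticData k) : D.dual.one ≠ 0 := modRel_one_ne_zero _

theorem exists_cochain_ne_zero (D : QuadraticData k) : ∃ f : Cochain D.testAlgebra 0, f ≠ 0 := by
  let φ : (endOperad k D.testAlgebra.carrier).obj 1 :=
    (prodForm (V := D.TestSpace) fun _ : Fin 1 => D.testCoord 0).smulRight
      ((0, 0, 1) : D.TestSpace)
  have hφ : testCoeff 1 φ = 1 := by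
    change (prodForm (V := D.TestSpace) (fun _ : Fin 1 => D.testCoord 0)
      (fun j : Fin 1 => D.testVector j) • ((0, 0, 1) : D.TestSpace)).2.2 = 1
    rw [prodForm_apply]
    simp [testCoord, testVector]
  refine ⟨⟨φ ⊗ₜ[k] D.dual.one, mem_cochain.2 fun σ => ?_⟩, fun h => D.dual_one_ne_zero ?_⟩
  · rw [show σ = 1 from Subsingleton.elim (α := Equiv.Perm (Fin 1)) _ _, twist_one]
  · have h1 : testRead 1 (φ ⊗ₜ[k] D.dual.one) = 0 := by
      rw [show φ ⊗ₜ[k] D.dual.one = 0 from congrArg Subtype.val h, map_zero]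
    rwa [testRead_tmul, hφ, one_smul] at h1

theorem one_Z0_ne_zero [CharZero k] : (1 : D.Z0) ≠ 0 := by
  intro h
  obtain ⟨f, hf⟩ := exists_cochain_ne_zero D
  have h1 := LinearMap.congr_fun (congrFun (congrArg Subtype.val h) D.testAlgebra) (incl _ 0 f)
  exact hf (incl_injective _ 0 (h1.trans (map_zero _).symm))

theorem coboundaries_eq_bot [CharZero k] : D.coboundaries = ⊥ := by
  refine le_bot_iff.1 (TwoSidedIdeal.span_le.2 ?_)
  rintro z ⟨V, hV, hz⟩
  rw [B_neg_one, Submodule.mem_bot] at hV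
  rw [hV, map_zero] at hz
  exact (TwoSidedIdeal.mem_bot _).2 (Subtype.ext hz)

theorem bijective_algebraMap_H0 [CharZero k] : Function.Bijective (Algebra.ofId k D.H0) := by
  have : Nontrivial D.H0 := by
    refine ⟨1, 0, fun h => one_Z0_ne_zero (D := D) ?_⟩
    have h1 : D.coboundaries.ringCon 1 0 := (RingCon.eq _).1 h
    rwa [← TwoSidedIdeal.mem_iff, coboundaries_eq_bot, TwoSidedIdeal.mem_bot] at h1
  refine ⟨(Algebra.ofId k D.H0).toRingHom.injective, fun x => ?_⟩
  obtain ⟨z, rfl⟩ := D.coboundaries.ringCon.mk'_surjective x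
  obtain ⟨c, rfl⟩ := Z0_eq_algebraMap z
  exact ⟨c, rfl⟩

/-- An endomorphism `α` of an operad as a module over itself is determined by `α(1)`, because
`α(q) = α(1 ∘₁ q) = α(1) ∘₁ q`; for `P^!` the value `α(1)` is a multiple of `1`. -/
theorem bijective_algebraMap_selfEnd : Function.Bijective (Algebra.ofId k D.dual.selfEnd) := by
  have : Nontrivial D.dual.selfEnd := by
    refine ⟨1, 0, fun h => D.dual_one_ne_zero ?_⟩
    exact LinearMap.congr_fun (congrFun (congrArg Subtype.val h) 1) D.dual.one
  refine ⟨(Algebra.ofId k D.dual.selfEnd).toRingHom.injective, fun α => ?_⟩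
  obtain ⟨c, hc⟩ : ∃ c : k, c • D.dual.one = α.1 1 D.dual.one :=
    Submodule.mem_span_singleton.1 (mem_graftSpan (R := D.dualR) (n := 1) _)
  refine ⟨c, Subtype.ext (funext fun n => LinearMap.ext fun q => ?_)⟩
  change c • q = α.1 n q
  have : IsEmpty {x : Fin 1 // x ≠ 0} := ⟨fun x => x.2 (Subsingleton.elim _ _)⟩
  have hq : D.dual.comp 0 (Equiv.emptySum _ _ : Graft (0 : Fin 1) n n) D.dual.one q = q := by
    rw [D.dual.one_comp 0 _ (Equiv.refl _) fun _ => rfl, D.dual.relabel_refl]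
  conv_rhs => rw [← hq, α.2.2.2, ← hc, map_smul, LinearMap.smul_apply, hq]

theorem coe_induced (α : D.dual.selfEnd) (A : D.operad.Alg) (m : ℕ) (f : Cochain A m) :
    (induced α A m f : D.Pre A (m + 1)) =
      TensorProduct.map LinearMap.id (α.1 (m + 1)) (f : D.Pre A (m + 1)) :=
  rfl

theorem induced_algebraMap (c : k) (A : D.operad.Alg) (m : ℕ) (f : Cochain A m) :
    induced (algebraMap k D.dual.selfEnd c) A m f = c • f := by
  have h : (algebraMap k D.dual.selfEnd c).1 (m + 1) = c • LinearMap.id := rfl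
  apply Subtype.ext
  rw [coe_induced, h, TensorProduct.map_smul_right, TensorProduct.map_id, LinearMap.smul_apply,
    LinearMap.id_apply, Submodule.coe_smul]

theorem algebraMap_Z0_apply [CharZero k] (c : k) (A : D.operad.Alg) (x : D.Total A) :
    (algebraMap k D.Z0 c : D.Ambient) A x = c • x :=
  rfl

end QuadraticData
end OperadicNatOp

theorem mainTheorem6 {k : Type u} [Field k] [CharZero k] (D : OperadicNatOp.QuadraticData k) :
    ∃ (Θ : D.H0 ≃ₐ[k] D.dual.selfEnd) (ev : D.dual.selfEnd ≃ₐ[k] k),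
      (∀ (z : D.Z0) (A : D.operad.Alg) (m : ℕ) (f : OperadicNatOp.QuadraticData.Cochain A m),
        (z : D.Ambient) A (OperadicNatOp.QuadraticData.incl A m f) =
          OperadicNatOp.QuadraticData.incl A m
            (OperadicNatOp.QuadraticData.induced (Θ (D.coboundaries.ringCon.mk' z)) A m f)) ∧
      (∀ α : D.dual.selfEnd,
        (α : ∀ n : ℕ, Module.End k (D.dual.obj n)) 1 D.dual.one = ev α • D.dual.one) := by
  let e₁ : k ≃ₐ[k] D.H0 :=
    AlgEquiv.ofBijective _ OperadicNatOp.QuadraticData.bijective_algebraMap_H0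
  let e₂ : k ≃ₐ[k] D.dual.selfEnd :=
    AlgEquiv.ofBijective _ OperadicNatOp.QuadraticData.bijective_algebraMap_selfEnd
  refine ⟨e₁.symm.trans e₂, e₂.symm, fun z A m f => ?_, fun α => ?_⟩
  · obtain ⟨c, rfl⟩ := OperadicNatOp.QuadraticData.Z0_eq_algebraMap z
    have h : (e₁.symm.trans e₂) (D.coboundaries.ringCon.mk' (algebraMap k D.Z0 c)) =
        algebraMap k D.dual.selfEnd c := by
      rw [AlgEquiv.trans_apply, show D.coboundaries.ringCon.mk' (algebraMap k D.Z0 c) = e₁ c from rfl,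
        e₁.symm_apply_apply]
      rfl
    rw [h, OperadicNatOp.QuadraticData.induced_algebraMap, map_smul,
      OperadicNatOp.QuadraticData.algebraMap_Z0_apply]
  · obtain ⟨c, rfl⟩ := e₂.surjective α
    rw [e₂.symm_apply_apply]
    rfl
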